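/- Let $\mathbb D=\{z\in\mathbb C:|z|<1\}$. A harmonic mapping in $\mathbb D$ is a complex-valued solution of Laplace's equation in $\mathbb D$; it has a unique representation $f=h+\overline g$ with $h,g$ analytic in $\mathbb D$ and $g(0)=0$. It is sense-preserving if its Jacobian $J_f=|h'|^2-|g'|^2$ is positive in $\mathbb D$, and then its pre-Schwarzian derivative and norm are $$P_f=\frac{h''\overline{h'}-g''\overline{g'}}{|h'|^2-|g'|^2},\qquad \|P_f\|=\sup_{z\in\mathbb D}(1-|z|^2)|P_f(z)|.$$ For $\lambda\ge 0$ let $\mathcal B_H(\lambda)$ be the set of sense-preserving harmonic mappings $f=h+\overline g$ in $\mathbb D$ with $h(0)=g(0)=0$, $h'(0)=1$ and $\|P_f\|\le\lambda$. For $0<p<\infty$ let $h^p$ be the space of harmonic mappings $f$ in $\mathbb D$ with $$\sup_{0<r<1}\left(\frac1{2\pi}\int_0^{2\pi}|f(re^{i\theta})|^p\,d\theta\right)^{1/p}<\infty .$$ For $a\in\mathbb D$ and $0<\rho\le\infty$ let $D_h(a,\rho)=\{z\in\mathbb D: 2\tanh^{-1}\left|\frac{z-a}{1-\overline a z}\right|<\rho\}$.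 A sense-preserving harmonic mapping $f$ in $\mathbb D$ is called uniformly locally univalent (ULU) if $$\inf_{z\in\mathbb D}\ \sup\{\rho_z\in(0,\infty]: f\text{ is univalent in }D_h(z,\rho_z)\}>0 .$$ (1) Let $\lambda\ge1$, and put $p_0(\lambda)=\frac{4}{(\lambda+3)(\lambda-1)}$ if $\lambda>1$ and $p_0(1)=\infty$. Then $\mathcal B_H(\lambda)\subset h^p$ for every real $p$ with $0<p<p_0(\lambda)$. (2) For every ULU harmonic mapping $f$ in $\mathbb D$ there is a $p=p(f)>0$ with $f\in h^p$. -/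

import Mathlib

open scoped ENNReal ComplexConjugate

namespace HarmonicHardy

noncomputable section

/-- The open unit disk `𝔻` of the complex plane. -/
abbrev disk : Set ℂ := Metric.ball (0 : ℂ) 1

/-- A harmonic mapping in `𝔻`: a complex-valued `C²` solution of the Laplace equation in `𝔻`.
Only the values of `f` in `𝔻` matter. -/
def IsHarmonicMapping (f : ℂ → ℂ) : Prop :=
  InnerProductSpace.HarmonicOnNhd f disk

/-- The Jacobian `J_f` of `f`, as a map between real planes. -/
def jacobian (f : ℂ → ℂ) (z : ℂ) : ℝ := (fderiv ℝ f z).det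

/-- A sense-preserving harmonic mapping in `𝔻`: harmonic with `J_f > 0` everywhere in `𝔻`. -/
def IsSensePreservingHarmonic (f : ℂ → ℂ) : Prop :=
  IsHarmonicMapping f ∧ ∀ z ∈ disk, 0 < jacobian f z

/-- `f = h + conj g` is the canonical representation of `f` in `𝔻`: the functions `h` and `g` are
analytic in `𝔻`, and `g 0 = 0`. -/
structure IsCanonicalRep (f h g : ℂ → ℂ) : Prop where
  analytic_h : DifferentiableOn ℂ h disk
  analytic_g : DifferentiableOn ℂ g disk
  g_zero : g 0 = 0
  eq_add : ∀ z ∈ disk, f z = h z + conj (g z)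

/-- The pre-Schwarzian derivative of `f = h + conj g`,
`P_f = (h'' conj h' - g'' conj g') / (|h'|² - |g'|²)`. -/
def preSchwarzian (h g : ℂ → ℂ) (z : ℂ) : ℂ :=
  (deriv (deriv h) z * conj (deriv h z) - deriv (deriv g) z * conj (deriv g z)) /
    ((‖deriv h z‖ ^ 2 - ‖deriv g z‖ ^ 2 : ℝ) : ℂ)

/-- The pre-Schwarzian norm `sup_{z ∈ 𝔻} (1 - |z|²) |P_f(z)|`, with values in `[0, ∞]`. -/
def preSchwarzianNorm (h g : ℂ → ℂ) : ℝ≥0∞ :=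
  ⨆ z ∈ disk, ENNReal.ofReal ((1 - ‖z‖ ^ 2) * ‖preSchwarzian h g z‖)

/-- The class `B_H(lam)` of the sense-preserving harmonic mappings `f = h + conj g` in `𝔻` with
`h(0) = h'(0) - 1 = g(0) = 0` and pre-Schwarzian norm at most `lam`. -/
def classBH (lam : ℝ) : Set (ℂ → ℂ) :=
  {f | IsSensePreservingHarmonic f ∧ ∃ h g : ℂ → ℂ, IsCanonicalRep f h g ∧
    h 0 = 0 ∧ deriv h 0 = 1 ∧ preSchwarzianNorm h g ≤ ENNReal.ofReal lam}

/-- The hyperbolic distance `2 artanh |(z - a) / (1 - conj a * z)|` in `𝔻`. -/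
def hypDist (z a : ℂ) : ℝ := 2 * Real.artanh ‖(z - a) / (1 - conj a * z)‖

/-- The hyperbolic disk with center `a` and hyperbolic radius `r ∈ (0, ∞]`. -/
def hypDisk (a : ℂ) (r : ℝ≥0∞) : Set ℂ := {z ∈ disk | ENNReal.ofReal (hypDist z a) < r}

/-- The uniformly hyperbolic radius: the infimum over `z ∈ 𝔻` of the supremum of the radii
`r > 0` such that `f` is univalent in the hyperbolic disk with center `z` and radius `r`. -/
def uniformHypRadius (f : ℂ → ℂ) : ℝ≥0∞ :=
  ⨅ z ∈ disk, sSup {r : ℝ≥0∞ | 0 < r ∧ Set.InjOn f (hypDisk z r)}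

/-- A uniformly locally univalent (sense-preserving) harmonic mapping in `𝔻`. -/
def IsULUHarmonic (f : ℂ → ℂ) : Prop :=
  IsSensePreservingHarmonic f ∧ 0 < uniformHypRadius f

/-- The integral mean `I_p(r, f) = (1 / 2π) ∫₀^{2π} |f(r e^{iθ})|^p dθ`. -/
def integralMean (p r : ℝ) (f : ℂ → ℂ) : ℝ :=
  (2 * Real.pi)⁻¹ * ∫ θ in (0 : ℝ)..(2 * Real.pi), ‖f (circleMap 0 r θ)‖ ^ p

/-- `‖f‖_p = sup_{0 < r < 1} I_p(r, f)^{1/p}`, with values in `[0, ∞]`. -/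
def hardyNorm (p : ℝ) (f : ℂ → ℂ) : ℝ≥0∞ :=
  ⨆ r ∈ Set.Ioo (0 : ℝ) 1, ENNReal.ofReal (integralMean p r f ^ (1 / p))

/-- The harmonic Hardy space `h^p`, for `0 < p < ∞`. -/
def harmonicHardy (p : ℝ) : Set (ℂ → ℂ) :=
  {f | IsHarmonicMapping f ∧ hardyNorm p f < ∞}

/-- The bound `p₀(lam) = 4 / ((lam + 3) (lam - 1))` for `lam > 1`, and `p₀(1) = ∞`. -/
def criticalExponent (lam : ℝ) : EReal :=
  if lam = 1 then ⊤ else ((4 / ((lam + 3) * (lam - 1)) : ℝ) : EReal)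

end

end HarmonicHardy

/-!
Let `f = h + conj g` be sense-preserving, so that `‖g'‖ < ‖h'‖`, and suppose that
`(1 - ‖z‖²) ‖h'' / h'‖ ≤ μ` in the disk. Then `f` lies in `h^p` whenever `p (μ² - 4) < 4`
(`hardyNorm_lt_top`). Indeed `h'` has no zeros, and in the coordinate `z = exp (x + iθ)` the mean
`J x` of `‖h'‖ ^ p = ‖Φ‖²`, with `Φ` holomorphic and `2πi`-periodic, satisfies
`J'' = 4 ∫ ‖Φ'‖² ≤ (p² μ² / 4) J / x²` (`hasDerivAt_integral_mul_conj`). Comparison with the Euler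
equation gives `J x = O((-x) ^ (-a))` with `4 a (a + 1) = p² μ²`, and the condition on `p` means
`a < p`. As `‖h'‖` varies by a bounded factor on dyadic radial segments, summing the radial
increments of `h` and `g` over the segments bounds the means of `‖f‖ ^ p`.

For `f ∈ B_H(lam)` one may take `μ = lam + 1`: the pre-Schwarzian derivatives of `f` and `h` differ
by `ω' conj ω / (1 - ‖ω‖²)` with `ω = g' / h'`, which the Schwarz–Pick lemma controls
(`one_sub_sq_mul_norm_le_of_preSchwarzianNorm_le`). Then `p (μ² - 4) < 4` reads `p < p₀(lam)`.

For a uniformly locally univalent `f` some finite `μ` exists (`one_sub_sq_mul_norm_le_of_injOn`), and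
`p = 1 / μ²` will do. If `(1 - ‖z‖²) ‖h'' / h'‖` were unbounded, one could select points around which
the rescaled mapping lives on a huge disk, has `h'' / h' = 1` at the center and `‖h'' / h'‖ ≤ 2`
throughout. By the Schwarz lemma `h'` is then close to a multiple of `exp`, while `g' / h'` is nearly
constant; after a real-linear map of the image the rescaled mapping is `C¹`-close to `exp` near `0`
and `2πi`, hence takes a common value at two points (`not_injOn_of_large_radius`).
-/

namespace HarmonicHardy

open Metric Set

/-! ### Logarithms of zero-free functions and the Schwarz–Pick lemma -/

/-- A zero-free holomorphic function on a disk with center `c` is `F c * exp L`, where `L` is the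
primitive of the logarithmic derivative that vanishes at `c`. -/
lemma exists_exp_eq_of_ne_zero {F : ℂ → ℂ} {c : ℂ} {R : ℝ} (hR : 0 < R)
    (hF : DifferentiableOn ℂ F (ball c R)) (h0 : ∀ z ∈ ball c R, F z ≠ 0) :
    ∃ L : ℂ → ℂ, L c = 0 ∧ (∀ z ∈ ball c R, HasDerivAt L (deriv F z / F z) z) ∧
      ∀ z ∈ ball c R, F z = F c * Complex.exp (L z) := by
  have hq : DifferentiableOn ℂ (fun z => deriv F z / F z) (ball c R) :=
    (hF.deriv isOpen_ball).div hF h0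
  obtain ⟨L, hLc, hL⟩ := hq.isExactOn_ball.with_val_at c 0
  refine ⟨L, hLc, hL, fun z hz => ?_⟩
  have hd : ∀ y ∈ ball c R, HasDerivAt (fun z => F z * Complex.exp (-L z)) 0 y := by
    intro y hy
    have h1 := (hF.differentiableAt (isOpen_ball.mem_nhds hy)).hasDerivAt
    have h2 := h1.mul (hL y hy).neg.cexp
    refine h2.congr_deriv ?_
    field_simp [h0 y hy]
    ring
  have := isOpen_ball.is_const_of_deriv_eq_zero (𝕜 := ℂ) (convex_ball c R).isPreconnected
    (fun y hy => (hd y hy).differentiableAt.differentiableWithinAt)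
    (fun y hy => (hd y hy).deriv) hz (mem_ball_self hR)
  simp only [hLc, neg_zero, Complex.exp_zero, mul_one] at this
  rw [← this, mul_assoc, ← Complex.exp_add]
  simp

lemma normSq_one_sub_conj_mul_sub (c w : ℂ) :
    ‖1 - conj c * w‖ ^ 2 - ‖w - c‖ ^ 2 = (1 - ‖c‖ ^ 2) * (1 - ‖w‖ ^ 2) := by
  simp only [← Complex.normSq_eq_norm_sq, Complex.normSq_apply, Complex.sub_re, Complex.sub_im,
    Complex.mul_re, Complex.mul_im, Complex.conj_re, Complex.conj_im, Complex.one_re,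
    Complex.one_im]
  ring

lemma one_sub_conj_mul_ne_zero {c w : ℂ} (hc : ‖c‖ < 1) (hw : ‖w‖ < 1) :
    1 - conj c * w ≠ 0 := by
  intro h
  have h1 : conj c * w = 1 := (sub_eq_zero.mp h).symm
  have h2 := congrArg norm h1
  rw [norm_mul, Complex.norm_conj, norm_one] at h2
  nlinarith [norm_nonneg c, norm_nonneg w]

lemma norm_sub_div_one_sub_conj_mul_lt_one {c w : ℂ} (hc : ‖c‖ < 1) (hw : ‖w‖ < 1) :
    ‖(w - c) / (1 - conj c * w)‖ < 1 := by
  have h0 := norm_pos_iff.mpr (one_sub_conj_mul_ne_zero hc hw)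
  rw [norm_div, div_lt_one h0]
  refine lt_of_pow_lt_pow_left₀ 2 h0.le ?_
  have := normSq_one_sub_conj_mul_sub c w
  have h1 : 0 < 1 - ‖c‖ ^ 2 := by nlinarith [norm_nonneg c]
  have h2 : 0 < 1 - ‖w‖ ^ 2 := by nlinarith [norm_nonneg w]
  nlinarith [mul_pos h1 h2]

/-- The Schwarz–Pick lemma for the center of a disk and another point of it. -/
lemma norm_sub_le_mul_norm_one_sub_conj_mul {w : ℂ → ℂ} {c z : ℂ} {R : ℝ}
    (hd : DifferentiableOn ℂ w (ball c R)) (hm : ∀ y ∈ ball c R, ‖w y‖ < 1) (hz : z ∈ ball c R) :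
    ‖w z - w c‖ ≤ ‖z - c‖ / R * ‖1 - conj (w c) * w z‖ := by
  have hR : 0 < R := nonempty_ball.mp ⟨z, hz⟩
  have hwc := hm c (mem_ball_self hR)
  have hne : ∀ y ∈ ball c R, 1 - conj (w c) * w y ≠ 0 :=
    fun y hy => one_sub_conj_mul_ne_zero hwc (hm y hy)
  have hT : DifferentiableOn ℂ (fun y => (w y - w c) / (1 - conj (w c) * w y)) (ball c R) :=
    (hd.sub_const _).div ((hd.const_mul _).const_sub _) hne
  have := Complex.dist_le_div_mul_dist_of_mapsTo_ball (R₂ := 1) hT (fun y hy => by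
    simpa using (norm_sub_div_one_sub_conj_mul_lt_one hwc (hm y hy)).le) hz
  rw [dist_eq_norm, dist_eq_norm, sub_self, zero_div, sub_zero, norm_div,
    div_le_iff₀ (norm_pos_iff.mpr (hne z hz))] at this
  calc _ ≤ _ := this
    _ = _ := by ring

/-- The invariant form of the Schwarz–Pick lemma in the unit disk. -/
lemma one_sub_sq_mul_norm_deriv_le {w : ℂ → ℂ} (hd : DifferentiableOn ℂ w disk)
    (hm : ∀ y ∈ disk, ‖w y‖ < 1) {a : ℂ} (ha : a ∈ disk) :
    (1 - ‖a‖ ^ 2) * ‖deriv w a‖ ≤ 1 - ‖w a‖ ^ 2 := by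
  have ha' : ‖a‖ < 1 := by simpa using ha
  have hwa := hm a ha
  -- the disk automorphism that maps `0` to `a`
  set φ : ℂ → ℂ := fun y => (y - -a) / (1 - conj (-a) * y) with hφ
  have hna : ‖-a‖ < 1 := by simpa using ha'
  have hφm : ∀ y ∈ disk, φ y ∈ disk := fun y hy => by
    exact mem_ball_zero_iff.mpr
      (norm_sub_div_one_sub_conj_mul_lt_one hna (mem_ball_zero_iff.mp hy))
  have hφne : ∀ y ∈ disk, 1 - conj (-a) * y ≠ 0 := fun y hy =>
    one_sub_conj_mul_ne_zero hna (by simpa using hy)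
  have hφd : DifferentiableOn ℂ φ disk :=
    (differentiableOn_id.sub_const _).div ((differentiableOn_id.const_mul _).const_sub _) hφne
  have hφ0 : φ 0 = a := by simp [hφ]
  have hφ' : HasDerivAt φ (1 - conj a * a) 0 := by
    have h1 : HasDerivAt (fun y : ℂ => y - -a) 1 0 := (hasDerivAt_id _).sub_const _
    have h2 : HasDerivAt (fun y : ℂ => 1 - conj (-a) * y) (-(conj (-a) * 1)) 0 :=
      ((hasDerivAt_id (0 : ℂ)).const_mul _).const_sub _
    refine (h1.div h2 (by simp)).congr_deriv ?_
    simp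
    ring
  set u : ℂ → ℂ := fun y => w (φ y) with hu
  have hum : ∀ y ∈ disk, ‖u y‖ < 1 := fun y hy => hm _ (hφm y hy)
  have hud : DifferentiableOn ℂ u disk := hd.comp hφd hφm
  have hu0 : u 0 = w a := by simp [hu, hφ0]
  have hu' : HasDerivAt u (deriv w a * (1 - conj a * a)) 0 := by
    have h1 : HasDerivAt w (deriv w a) (φ 0) := by
      rw [hφ0]; exact (hd.differentiableAt (isOpen_ball.mem_nhds ha)).hasDerivAt
    exact h1.comp 0 hφ'
  have hne : ∀ y ∈ disk, 1 - conj (w a) * u y ≠ 0 := fun y hy =>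
    one_sub_conj_mul_ne_zero hwa (hum y hy)
  have hT : DifferentiableOn ℂ (fun y => (u y - w a) / (1 - conj (w a) * u y)) disk :=
    (hud.sub_const _).div ((hud.const_mul _).const_sub _) hne
  have h0 : (0 : ℂ) ∈ disk := by simp
  have key := Complex.norm_deriv_le_one_of_mapsTo_ball hT (fun y hy => by
    simpa [hu0] using (norm_sub_div_one_sub_conj_mul_lt_one hwa (hum y hy)).le) one_pos
  have hn0 := hne 0 h0
  rw [hu0] at hn0
  have hT' : HasDerivAt (fun y => (u y - w a) / (1 - conj (w a) * u y))
      (deriv w a * (1 - conj a * a) / (1 - conj (w a) * w a)) 0 := by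
    refine ((hu'.sub_const (w a)).div ((hu'.const_mul _).const_sub _) (hne 0 h0)).congr_deriv ?_
    rw [hu0]
    field_simp
    ring
  have e : ∀ x : ℂ, 1 - conj x * x = ((1 - ‖x‖ ^ 2 : ℝ) : ℂ) := fun x => by
    rw [mul_comm, Complex.mul_conj, Complex.normSq_eq_norm_sq]; push_cast; ring
  have p1 : 0 < 1 - ‖a‖ ^ 2 := by nlinarith [norm_nonneg a]
  have p2 : 0 < 1 - ‖w a‖ ^ 2 := by nlinarith [norm_nonneg (w a)]
  rw [hT'.deriv, e, e, norm_div, norm_mul, Complex.norm_real, Complex.norm_real,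
    Real.norm_of_nonneg p1.le, Real.norm_of_nonneg p2.le, div_le_one p2] at key
  linarith

/-! ### The canonical representation and the Jacobian -/

/-- A harmonic mapping of the disk has a canonical representation: the real and imaginary parts are
real parts of holomorphic `F₁` and `F₂`, and `2 h = F₁ + i F₂`, `2 g = F₁ - i F₂` up to constants. -/
lemma exists_isCanonicalRep {f : ℂ → ℂ} (hf : IsHarmonicMapping f) :
    ∃ h g : ℂ → ℂ, IsCanonicalRep f h g := by
  have h1 : InnerProductSpace.HarmonicOnNhd (fun z => (f z).re) disk :=
    fun z hz => (hf z hz).comp_CLM Complex.reCLM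
  have h2 : InnerProductSpace.HarmonicOnNhd (fun z => (f z).im) disk :=
    fun z hz => (hf z hz).comp_CLM Complex.imCLM
  obtain ⟨F₁, hF₁, e₁⟩ := h1.exists_analyticOnNhd_ball_re_eq
  obtain ⟨F₂, hF₂, e₂⟩ := h2.exists_analyticOnNhd_ball_re_eq
  have d₁ := hF₁.differentiableOn
  have d₂ := hF₂.differentiableOn
  refine ⟨fun z => (F₁ z + Complex.I * F₂ z) / 2 + conj ((F₁ 0 - Complex.I * F₂ 0) / 2),
    fun z => (F₁ z - Complex.I * F₂ z) / 2 - (F₁ 0 - Complex.I * F₂ 0) / 2, ?_, ?_, by simp, ?_⟩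
  · exact ((d₁.add (d₂.const_mul _)).div_const _).add_const _
  · exact ((d₁.sub (d₂.const_mul _)).div_const _).sub_const _
  · intro z hz
    have a1 := e₁ hz
    have a2 := e₂ hz
    simp only at a1 a2
    simp only [map_sub, map_div₀, map_mul, Complex.conj_I, map_ofNat]
    apply Complex.ext
    · simp [← a1]; ring
    · simp [← a2]; ring

lemma jacobian_eq {f h g : ℂ → ℂ} (hc : IsCanonicalRep f h g) {z : ℂ} (hz : z ∈ disk) :
    jacobian f z = ‖deriv h z‖ ^ 2 - ‖deriv g z‖ ^ 2 := by
  have hn : disk ∈ nhds z := isOpen_ball.mem_nhds hz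
  have dh := ((hc.analytic_h.differentiableAt hn).hasDerivAt).hasFDerivAt.restrictScalars ℝ
  have dg := ((hc.analytic_g.differentiableAt hn).hasDerivAt).hasFDerivAt.restrictScalars ℝ
  have dg' := Complex.conjCLE.toContinuousLinearMap.hasFDerivAt.comp z dg
  have df := (dh.add dg').congr_of_eventuallyEq (f₁ := f)
    (Filter.eventually_of_mem hn fun y hy => by simpa using hc.eq_add y hy)
  rw [jacobian, df.fderiv, ContinuousLinearMap.det,
    ← LinearMap.det_toMatrix Complex.basisOneI, Matrix.det_fin_two]
  simp [LinearMap.toMatrix_apply, ← Complex.normSq_eq_norm_sq, Complex.normSq_apply]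
  ring

lemma norm_deriv_lt_of_isSensePreservingHarmonic {f h g : ℂ → ℂ} (hf : IsSensePreservingHarmonic f)
    (hc : IsCanonicalRep f h g) {z : ℂ} (hz : z ∈ disk) : ‖deriv g z‖ < ‖deriv h z‖ := by
  have := hf.2 z hz
  rw [jacobian_eq hc hz] at this
  exact lt_of_pow_lt_pow_left₀ 2 (norm_nonneg _) (by linarith)

/-! ### Integral means of functions on the left half-plane -/

/-- The open left half-plane, which `Complex.exp` maps onto the punctured unit disk. -/
abbrev leftHalfPlane : Set ℂ := {ζ | ζ.re < 0}

lemma isOpen_leftHalfPlane : IsOpen leftHalfPlane :=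
  isOpen_lt Complex.continuous_re continuous_const

lemma line_mem_leftHalfPlane {x : ℝ} (hx : x < 0) (θ : ℝ) :
    (x + θ * Complex.I : ℂ) ∈ leftHalfPlane := by simpa using hx

/-- For `2πi`-periodic holomorphic functions the derivative of the mean of `Φ * conj Ψ` over a
vertical period only involves `deriv Ψ`: integration by parts along the period moves the
derivative from one factor to the other. -/
lemma hasDerivAt_integral_mul_conj {Φ Ψ : ℂ → ℂ} (hΦ : DifferentiableOn ℂ Φ leftHalfPlane)
    (hΨ : DifferentiableOn ℂ Ψ leftHalfPlane)
    (pΦ : ∀ ζ, Φ (ζ + 2 * Real.pi * Complex.I) = Φ ζ)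
    (pΨ : ∀ ζ, Ψ (ζ + 2 * Real.pi * Complex.I) = Ψ ζ) {x : ℝ} (hx : x < 0) :
    HasDerivAt (fun x : ℝ => ∫ θ in (0 : ℝ)..(2 * Real.pi),
        Φ (x + θ * Complex.I) * conj (Ψ (x + θ * Complex.I)))
      (2 * ∫ θ in (0 : ℝ)..(2 * Real.pi),
        Φ (x + θ * Complex.I) * conj (deriv Ψ (x + θ * Complex.I))) x := by
  have hΦ' := hΦ.deriv isOpen_leftHalfPlane
  have hΨ' := hΨ.deriv isOpen_leftHalfPlane
  have cont : ∀ {F : ℂ → ℂ}, DifferentiableOn ℂ F leftHalfPlane →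
      ContinuousOn (fun q : ℝ × ℝ => F (q.1 + q.2 * Complex.I)) {q | q.1 < 0} := fun hF =>
    hF.continuousOn.comp (by fun_prop) fun q hq => line_mem_leftHalfPlane hq q.2
  have cont1 : ∀ {F : ℂ → ℂ}, DifferentiableOn ℂ F leftHalfPlane → ∀ {y : ℝ}, y < 0 →
      Continuous fun θ : ℝ => F (y + θ * Complex.I) := by
    intro F hF y hy
    exact continuousOn_univ.mp <|
      (cont hF).comp (f := fun θ : ℝ => (y, θ)) (by fun_prop) fun _ _ => hy
  have hasD : ∀ {F : ℂ → ℂ}, DifferentiableOn ℂ F leftHalfPlane → ∀ {y θ : ℝ}, y < 0 →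
      HasDerivAt F (deriv F (y + θ * Complex.I)) (y + θ * Complex.I) := by
    intro F hF y θ hy
    exact (hF.differentiableAt
      (isOpen_leftHalfPlane.mem_nhds (line_mem_leftHalfPlane hy θ))).hasDerivAt
  have dx : ∀ {F : ℂ → ℂ}, DifferentiableOn ℂ F leftHalfPlane → ∀ {y θ : ℝ}, y < 0 →
      HasDerivAt (fun y : ℝ => F (y + θ * Complex.I)) (deriv F (y + θ * Complex.I)) y := by
    intro F hF y θ hy
    have h1 : HasDerivAt (fun y : ℂ => F (y + θ * Complex.I)) (deriv F (y + θ * Complex.I)) y :=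
      HasDerivAt.comp_add_const (y : ℂ) (θ * Complex.I) (hasD hF hy)
    exact h1.comp_ofReal
  have dθ : ∀ {F : ℂ → ℂ}, DifferentiableOn ℂ F leftHalfPlane → ∀ {y θ : ℝ}, y < 0 →
      HasDerivAt (fun θ : ℝ => F (y + θ * Complex.I))
        (deriv F (y + θ * Complex.I) * Complex.I) θ := by
    intro F hF y θ hy
    have h2 : HasDerivAt (fun θ : ℂ => y + θ * Complex.I) Complex.I (θ : ℂ) := by
      simpa using ((hasDerivAt_id (θ : ℂ)).mul_const Complex.I).const_add (y : ℂ)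
    have h1 : HasDerivAt (fun θ : ℂ => F (y + θ * Complex.I))
        (deriv F (y + θ * Complex.I) * Complex.I) (θ : ℂ) := (hasD hF hy).comp (θ : ℂ) h2
    exact h1.comp_ofReal
  have c1 : Continuous fun θ : ℝ => deriv Φ (x + θ * Complex.I) *
      conj (Ψ (x + θ * Complex.I)) :=
    (cont1 hΦ' hx).mul (Complex.continuous_conj.comp (cont1 hΨ hx))
  have c2 : Continuous fun θ : ℝ => Φ (x + θ * Complex.I) *
      conj (deriv Ψ (x + θ * Complex.I)) :=
    (cont1 hΦ hx).mul (Complex.continuous_conj.comp (cont1 hΨ' hx))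
  -- the two halves of the derivative have the same integral
  have parts : ∫ θ in (0 : ℝ)..(2 * Real.pi), deriv Φ (x + θ * Complex.I) *
        conj (Ψ (x + θ * Complex.I)) =
      ∫ θ in (0 : ℝ)..(2 * Real.pi), Φ (x + θ * Complex.I) *
        conj (deriv Ψ (x + θ * Complex.I)) := by
    have hd : ∀ θ ∈ uIcc (0 : ℝ) (2 * Real.pi), HasDerivAt
        (fun θ : ℝ => Φ (x + θ * Complex.I) * conj (Ψ (x + θ * Complex.I)))
        (Complex.I * (deriv Φ (x + θ * Complex.I) * conj (Ψ (x + θ * Complex.I)) -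
          Φ (x + θ * Complex.I) * conj (deriv Ψ (x + θ * Complex.I)))) θ := by
      intro θ _
      refine ((dθ hΦ hx).mul (dθ hΨ hx).star).congr_deriv ?_
      simp
      ring
    have := intervalIntegral.integral_eq_sub_of_hasDerivAt hd
      ((continuous_const.mul (c1.sub c2)).intervalIntegrable _ _)
    rw [intervalIntegral.integral_const_mul, intervalIntegral.integral_sub
      (c1.intervalIntegrable _ _) (c2.intervalIntegrable _ _)] at this
    have e1 : Φ (x + ((2 * Real.pi : ℝ) : ℂ) * Complex.I) = Φ (x + ((0 : ℝ) : ℂ) * Complex.I) := by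
      rw [← pΦ (x + ((0 : ℝ) : ℂ) * Complex.I)]; simp
    have e2 : Ψ (x + ((2 * Real.pi : ℝ) : ℂ) * Complex.I) = Ψ (x + ((0 : ℝ) : ℂ) * Complex.I) := by
      rw [← pΨ (x + ((0 : ℝ) : ℂ) * Complex.I)]; simp
    rw [e1, e2, sub_self] at this
    exact sub_eq_zero.mp ((mul_eq_zero.mp this).resolve_left Complex.I_ne_zero)
  -- differentiation under the integral sign
  set G : ℝ × ℝ → ℂ := fun q => deriv Φ (q.1 + q.2 * Complex.I) * conj (Ψ (q.1 + q.2 * Complex.I))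
    + Φ (q.1 + q.2 * Complex.I) * conj (deriv Ψ (q.1 + q.2 * Complex.I)) with hG
  have hGc : ContinuousOn G {q | q.1 < 0} :=
    ((cont hΦ').mul (Complex.continuous_conj.comp_continuousOn (cont hΨ))).add
      ((cont hΦ).mul (Complex.continuous_conj.comp_continuousOn (cont hΨ')))
  obtain ⟨C, hC⟩ := (isCompact_Icc.prod isCompact_uIcc :
      IsCompact (Icc (2 * x) (x / 2) ×ˢ uIcc 0 (2 * Real.pi))).exists_bound_of_continuousOn
    (hGc.mono fun q hq => by
      have := hq.1.2
      exact (by linarith : q.1 < 0))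
  have hs : Icc (2 * x) (x / 2) ∈ nhds x := Icc_mem_nhds (by linarith) (by linarith)
  have cF : ∀ {y : ℝ}, y < 0 → Continuous fun θ : ℝ => Φ (y + θ * Complex.I) *
      conj (Ψ (y + θ * Complex.I)) := fun hy =>
    (cont1 hΦ hy).mul (Complex.continuous_conj.comp (cont1 hΨ hy))
  have cG : Continuous fun θ : ℝ => G (x, θ) :=
    ((cont1 hΦ' hx).mul (Complex.continuous_conj.comp (cont1 hΨ hx))).add
      ((cont1 hΦ hx).mul (Complex.continuous_conj.comp (cont1 hΨ' hx)))
  have key := (intervalIntegral.hasDerivAt_integral_of_dominated_loc_of_deriv_le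
    (μ := MeasureTheory.volume) (a := 0) (b := 2 * Real.pi)
    (F := fun (y θ : ℝ) => Φ (y + θ * Complex.I) * conj (Ψ (y + θ * Complex.I)))
    (F' := fun y θ => G (y, θ)) (bound := fun _ => C) hs
    (by
      filter_upwards [hs] with y hy
      exact (cF (by linarith [hy.2])).aestronglyMeasurable)
    ((cF hx).intervalIntegrable _ _) cG.aestronglyMeasurable
    (Filter.Eventually.of_forall fun θ hθ y hy => hC (y, θ) ⟨hy, uIoc_subset_uIcc hθ⟩)
    intervalIntegrable_const
    (Filter.Eventually.of_forall fun θ _ y hy => by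
      have hy0 : y < 0 := by linarith [hy.2]
      exact (dx hΦ hy0).mul (dx hΨ hy0).star)).2
  refine key.congr_deriv ?_
  simp only [hG]
  rw [intervalIntegral.integral_add (c1.intervalIntegrable _ _) (c2.intervalIntegrable _ _),
    parts]
  exact (two_mul _).symm

/-- Comparison with the solution `(-x) ^ (-a)` of the Euler equation `x² K'' = a (a + 1) K`. The
Wronskian of `J` and `K` decreases, so `J / K` has a derivative that is bounded above. -/
lemma exists_le_rpow_of_deriv_le {J J₁ J₂ : ℝ → ℝ} {a : ℝ} (ha : 0 ≤ a)
    (h₁ : ∀ x < 0, HasDerivAt J (J₁ x) x) (h₂ : ∀ x < 0, HasDerivAt J₁ (J₂ x) x)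
    (hJ : ∀ x < 0, J₂ x ≤ a * (a + 1) / x ^ 2 * J x) :
    ∃ C, ∀ x ∈ Ico (-1 : ℝ) 0, J x ≤ C * (-x) ^ (-a) := by
  have hK : ∀ (b : ℝ) {x : ℝ}, x < 0 → HasDerivAt (fun x : ℝ => (-x) ^ b)
      (-(b * (-x) ^ (b - 1))) x := by
    intro b x hx
    have := (hasDerivAt_neg x).rpow_const (p := b) (Or.inl (by linarith : -x ≠ 0))
    exact this.congr_deriv (by ring)
  -- the Wronskian `J' K - J K'` of `J` and `K x = (-x) ^ (-a)`
  set V : ℝ → ℝ := fun x => J₁ x * (-x) ^ (-a) - a * (J x * (-x) ^ (-a - 1)) with hV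
  have dV : ∀ x < 0, HasDerivAt V ((J₂ x - a * (a + 1) / x ^ 2 * J x) * (-x) ^ (-a)) x := by
    intro x hx
    have := ((h₂ x hx).mul (hK (-a) hx)).sub (((h₁ x hx).mul (hK (-a - 1) hx)).const_mul a)
    refine this.congr_deriv ?_
    have e : (-x) ^ (-a - 1 - 1) = (-x) ^ (-a) / x ^ 2 := by
      rw [show -a - 1 - 1 = -a - 2 by ring, Real.rpow_sub (by linarith), Real.rpow_two, neg_sq]
    rw [e]
    ring
  have aV : AntitoneOn V (Ico (-1) 0) := by
    refine antitoneOn_of_deriv_nonpos (convex_Ico _ _)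
      (fun x hx => (dV x hx.2).continuousAt.continuousWithinAt) (fun x hx => ?_) (fun x hx => ?_)
    · rw [interior_Ico] at hx
      exact (dV x hx.2).differentiableAt.differentiableWithinAt
    · rw [interior_Ico] at hx
      rw [(dV x hx.2).deriv]
      exact mul_nonpos_of_nonpos_of_nonneg (by linarith [hJ x hx.2])
        (Real.rpow_nonneg (by linarith [hx.2]) _)
  -- `(J / K)' = V / K²` is at most `|V (-1)|`, as `K ≥ 1` on `[-1, 0)`
  set Q : ℝ → ℝ := fun x => J x * (-x) ^ a - |V (-1)| * x with hQ
  have dQ : ∀ x < 0, HasDerivAt Q (V x * (-x) ^ (2 * a) - |V (-1)|) x := by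
    intro x hx
    have := ((h₁ x hx).mul (hK a hx)).sub ((hasDerivAt_id x).const_mul |V (-1)|)
    refine this.congr_deriv ?_
    have hx' : 0 < -x := by linarith
    have e1 : (-x) ^ (2 * a) * (-x) ^ (-a) = (-x) ^ a := by
      rw [← Real.rpow_add hx']; congr 1; ring
    have e2 : (-x) ^ (2 * a) * (-x) ^ (-a - 1) = (-x) ^ (a - 1) := by
      rw [← Real.rpow_add hx']; congr 1; ring
    simp only [hV]
    rw [← e1, ← e2]
    ring
  have aQ : AntitoneOn Q (Ico (-1) 0) := by
    refine antitoneOn_of_deriv_nonpos (convex_Ico _ _)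
      (fun x hx => (dQ x hx.2).continuousAt.continuousWithinAt) (fun x hx => ?_) (fun x hx => ?_)
    · rw [interior_Ico] at hx
      exact (dQ x hx.2).differentiableAt.differentiableWithinAt
    · rw [interior_Ico] at hx
      rw [(dQ x hx.2).deriv]
      have h1 : V x ≤ |V (-1)| :=
        (aV ⟨le_rfl, by norm_num⟩ ⟨hx.1.le, hx.2⟩ hx.1.le).trans (le_abs_self _)
      have h2 : (-x) ^ (2 * a) ≤ 1 :=
        Real.rpow_le_one (by linarith [hx.2]) (by linarith [hx.1]) (by linarith)
      have h3 : 0 ≤ (-x) ^ (2 * a) := Real.rpow_nonneg (by linarith [hx.2]) _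
      nlinarith [mul_le_mul_of_nonneg_right h1 h3, abs_nonneg (V (-1))]
  refine ⟨Q (-1), fun x hx => ?_⟩
  have h1 := aQ ⟨le_rfl, by norm_num⟩ hx hx.1
  have hx' : 0 < -x := by linarith [hx.2]
  have h2 : J x * (-x) ^ a ≤ Q (-1) := by
    have : |V (-1)| * x ≤ 0 := mul_nonpos_of_nonneg_of_nonpos (abs_nonneg _) hx.2.le
    simp only [hQ] at h1 ⊢
    linarith
  rw [Real.rpow_neg hx'.le, ← div_eq_mul_inv, le_div_iff₀ (Real.rpow_pos_of_pos hx' _)]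
  exact h2

/-- Growth of the mean of `‖Φ‖²`: its second derivative is four times the mean of `‖Φ'‖²`. -/
lemma exists_integral_norm_sq_le {Φ : ℂ → ℂ} (hΦ : DifferentiableOn ℂ Φ leftHalfPlane)
    (pΦ : ∀ ζ, Φ (ζ + 2 * Real.pi * Complex.I) = Φ ζ) {κ a : ℝ}
    (hκ : ∀ ζ ∈ leftHalfPlane, ‖deriv Φ ζ‖ ≤ κ / (-2 * ζ.re) * ‖Φ ζ‖)
    (ha : 0 ≤ a) (hκa : κ ^ 2 ≤ a * (a + 1)) :
    ∃ C, ∀ x ∈ Ico (-1 : ℝ) 0,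
      ∫ θ in (0 : ℝ)..(2 * Real.pi), ‖Φ (x + θ * Complex.I)‖ ^ 2 ≤ C * (-x) ^ (-a) := by
  have hΦ' := hΦ.deriv isOpen_leftHalfPlane
  have pΦ' : ∀ ζ, deriv Φ (ζ + 2 * Real.pi * Complex.I) = deriv Φ ζ := fun ζ => by
    rw [← deriv_comp_add_const]
    exact congrArg (fun F => deriv F ζ) (funext pΦ)
  have sq : ∀ (F : ℂ → ℂ) (x : ℝ), ∫ θ in (0 : ℝ)..(2 * Real.pi),
      ((F (x + θ * Complex.I) * conj (F (x + θ * Complex.I)) : ℂ)) =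
      ((∫ θ in (0 : ℝ)..(2 * Real.pi), ‖F (x + θ * Complex.I)‖ ^ 2 : ℝ) : ℂ) := fun F x => by
    rw [← intervalIntegral.integral_ofReal]
    refine intervalIntegral.integral_congr fun θ _ => ?_
    simp only [Complex.mul_conj, Complex.normSq_eq_norm_sq]
  have h₁ : ∀ x < (0 : ℝ), HasDerivAt
      (fun x : ℝ => ∫ θ in (0 : ℝ)..(2 * Real.pi), ‖Φ (x + θ * Complex.I)‖ ^ 2)
      (2 * ∫ θ in (0 : ℝ)..(2 * Real.pi),
        Φ (x + θ * Complex.I) * conj (deriv Φ (x + θ * Complex.I))).re x := fun x hx => by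
    have := (hasDerivAt_integral_mul_conj hΦ hΦ pΦ pΦ hx)
    simp only [sq] at this
    exact Complex.reCLM.hasFDerivAt.comp_hasDerivAt x this
  have h₂ : ∀ x < (0 : ℝ), HasDerivAt
      (fun x : ℝ => (2 * ∫ θ in (0 : ℝ)..(2 * Real.pi),
        Φ (x + θ * Complex.I) * conj (deriv Φ (x + θ * Complex.I))).re)
      (4 * ∫ θ in (0 : ℝ)..(2 * Real.pi), ‖deriv Φ (x + θ * Complex.I)‖ ^ 2) x := fun x hx => by
    have h1 := (hasDerivAt_integral_mul_conj hΦ' hΦ pΦ' pΦ hx)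
    rw [sq (deriv Φ) x] at h1
    have h2 := (Complex.reCLM.hasFDerivAt.comp_hasDerivAt x h1).const_mul 2
    refine (h2.congr_of_eventuallyEq (Filter.Eventually.of_forall fun y => ?_)).congr_deriv ?_
    · have : ∫ θ in (0 : ℝ)..(2 * Real.pi), deriv Φ (y + θ * Complex.I) *
          conj (Φ (y + θ * Complex.I)) = conj (∫ θ in (0 : ℝ)..(2 * Real.pi),
            Φ (y + θ * Complex.I) * conj (deriv Φ (y + θ * Complex.I))) := by
        rw [intervalIntegral.integral_of_le (by positivity),
          intervalIntegral.integral_of_le (by positivity), ← integral_conj]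
        simp [mul_comm]
      simp [this]
    · simp
      ring
  refine exists_le_rpow_of_deriv_le ha h₁ h₂ fun x hx => ?_
  have cont1 : ∀ {F : ℂ → ℂ}, DifferentiableOn ℂ F leftHalfPlane →
      Continuous fun θ : ℝ => ‖F (x + θ * Complex.I)‖ ^ 2 := fun hF =>
    (continuousOn_univ.mp <| hF.continuousOn.norm.comp (f := fun θ : ℝ => (x + θ * Complex.I : ℂ))
      (by fun_prop) fun θ _ => line_mem_leftHalfPlane hx θ).pow 2
  have hI0 : 0 ≤ ∫ θ in (0 : ℝ)..(2 * Real.pi), ‖Φ (x + θ * Complex.I)‖ ^ 2 :=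
    intervalIntegral.integral_nonneg (by positivity) fun _ _ => by positivity
  have hmono : ∫ θ in (0 : ℝ)..(2 * Real.pi), ‖deriv Φ (x + θ * Complex.I)‖ ^ 2 ≤
      κ ^ 2 / (4 * x ^ 2) * ∫ θ in (0 : ℝ)..(2 * Real.pi), ‖Φ (x + θ * Complex.I)‖ ^ 2 := by
    rw [← intervalIntegral.integral_const_mul]
    refine intervalIntegral.integral_mono (by positivity) ((cont1 hΦ').intervalIntegrable _ _)
      ((continuous_const.mul (cont1 hΦ)).intervalIntegrable _ _) fun θ => ?_
    have := pow_le_pow_left₀ (norm_nonneg _) (hκ _ (line_mem_leftHalfPlane hx θ)) 2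
    refine this.trans_eq ?_
    simp only [Complex.add_re, Complex.ofReal_re, Complex.re_ofReal_mul, Complex.I_re, mul_zero,
      add_zero]
    rw [mul_pow, div_pow, mul_pow]
    norm_num
  calc _ ≤ 4 * (κ ^ 2 / (4 * x ^ 2) *
        ∫ θ in (0 : ℝ)..(2 * Real.pi), ‖Φ (x + θ * Complex.I)‖ ^ 2) := by linarith
    _ = κ ^ 2 / x ^ 2 * ∫ θ in (0 : ℝ)..(2 * Real.pi), ‖Φ (x + θ * Complex.I)‖ ^ 2 := by
        rw [← mul_assoc, ← mul_div_assoc, mul_div_mul_left _ _ four_ne_zero]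
    _ ≤ _ := by gcongr

/-! ### Zero-free functions with a Bloch logarithm -/

lemma exp_mem_disk {ζ : ℂ} (hζ : ζ ∈ leftHalfPlane) : Complex.exp ζ ∈ disk := by
  rw [mem_ball_zero_iff, Complex.norm_exp]
  exact Real.exp_lt_one_iff.mpr hζ

/-- The pull-back of a logarithm of `k` to the left half-plane. The weight `1 - ‖z‖²` becomes
`2 sinh (-Re ζ)`, which is at least `-2 Re ζ`. -/
lemma exists_log_comp_exp {k : ℂ → ℂ} {μ : ℝ} (hk : DifferentiableOn ℂ k disk)
    (h0 : ∀ z ∈ disk, k z ≠ 0) (hb : ∀ z ∈ disk, (1 - ‖z‖ ^ 2) * ‖deriv k z / k z‖ ≤ μ) :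
    ∃ M : ℂ → ℂ, DifferentiableOn ℂ M leftHalfPlane ∧
      (∀ ζ, M (ζ + 2 * Real.pi * Complex.I) = M ζ) ∧
      (∀ ζ ∈ leftHalfPlane, ‖deriv M ζ‖ ≤ μ / (-2 * ζ.re)) ∧
      ∀ ζ ∈ leftHalfPlane, k (Complex.exp ζ) = k 0 * Complex.exp (M ζ) := by
  obtain ⟨L, -, hL, hkL⟩ := exists_exp_eq_of_ne_zero one_pos hk h0
  have hM : ∀ ζ ∈ leftHalfPlane, HasDerivAt (fun ζ => L (Complex.exp ζ))
      (deriv k (Complex.exp ζ) / k (Complex.exp ζ) * Complex.exp ζ) ζ := fun ζ hζ =>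
    (hL _ (exp_mem_disk hζ)).comp ζ (Complex.hasDerivAt_exp ζ)
  refine ⟨fun ζ => L (Complex.exp ζ), fun ζ hζ => (hM ζ hζ).differentiableAt.differentiableWithinAt,
    fun ζ => by simp only [Complex.exp_periodic ζ], fun ζ hζ => ?_,
    fun ζ hζ => hkL _ (exp_mem_disk hζ)⟩
  rw [(hM ζ hζ).deriv, norm_mul]
  have h1 := hb _ (exp_mem_disk hζ)
  have hre : ζ.re < 0 := hζ
  rw [Complex.norm_exp] at h1 ⊢
  set x := ζ.re
  have hsinh : -x ≤ Real.sinh (-x) := Real.self_le_sinh_iff.mpr (by linarith)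
  have he : 1 - Real.exp x ^ 2 = 2 * Real.sinh (-x) * Real.exp x := by
    rw [Real.sinh_eq, neg_neg, mul_div_cancel₀ _ two_ne_zero, sub_mul, ← Real.exp_add]
    simp [sq]
  rw [he] at h1
  rw [le_div_iff₀ (by linarith)]
  set q := ‖deriv k (Complex.exp ζ) / k (Complex.exp ζ)‖
  have hq : 0 ≤ q * Real.exp x := by positivity
  nlinarith [mul_le_mul_of_nonneg_left hsinh hq]

/-- Along a ray, `‖k‖` changes by a bounded factor while `-log ‖z‖` is at most halved. -/
lemma norm_comp_exp_le {k : ℂ → ℂ} {μ : ℝ} (hμ : 0 ≤ μ) (hk : DifferentiableOn ℂ k disk)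
    (h0 : ∀ z ∈ disk, k z ≠ 0) (hb : ∀ z ∈ disk, (1 - ‖z‖ ^ 2) * ‖deriv k z / k z‖ ≤ μ)
    {s t : ℝ} (hs : 0 < s) (hst : s ≤ t) (hts : t ≤ 2 * s) (θ : ℝ) :
    ‖k (Complex.exp (((-s : ℝ) : ℂ) + θ * Complex.I))‖ ≤
      Real.exp (μ / 2) * ‖k (Complex.exp (((-t : ℝ) : ℂ) + θ * Complex.I))‖ := by
  obtain ⟨M, hMd, -, hM', hkM⟩ := exists_log_comp_exp hk h0 hb
  have hd : ∀ y ∈ Icc (-t) (-s), HasDerivWithinAt (fun y : ℝ => M (y + θ * Complex.I))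
      (deriv M (y + θ * Complex.I)) (Icc (-t) (-s)) y := fun y hy => by
    have h1 := (hMd.differentiableAt (isOpen_leftHalfPlane.mem_nhds
      (line_mem_leftHalfPlane (by linarith [hy.2] : y < 0) θ))).hasDerivAt
    have h2 : HasDerivAt (fun y : ℂ => M (y + θ * Complex.I)) (deriv M (y + θ * Complex.I)) y :=
      HasDerivAt.comp_add_const (y : ℂ) (θ * Complex.I) h1
    exact h2.comp_ofReal.hasDerivWithinAt
  have hle := (convex_Icc (-t) (-s)).norm_image_sub_le_of_norm_hasDerivWithin_le
    (C := μ / (2 * s)) hd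
    (fun y hy => by
      refine (hM' _ (line_mem_leftHalfPlane (by linarith [hy.2] : y < 0) θ)).trans ?_
      have h1 := hy.2
      have : ((y : ℂ) + θ * Complex.I).re = y := by simp
      rw [this]
      exact div_le_div_of_nonneg_left hμ (by linarith) (by linarith))
    (left_mem_Icc.mpr (by linarith)) (right_mem_Icc.mpr (by linarith))
  have h3 : μ / (2 * s) * ‖(-s) - (-t)‖ ≤ μ / 2 := by
    rw [Real.norm_of_nonneg (by linarith), div_mul_eq_mul_div, div_le_div_iff₀ (by linarith) two_pos]
    nlinarith
  rw [hkM _ (line_mem_leftHalfPlane (by linarith) θ), hkM _ (line_mem_leftHalfPlane (by linarith) θ),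
    norm_mul, norm_mul, Complex.norm_exp, Complex.norm_exp, mul_left_comm, ← Real.exp_add]
  gcongr
  have h4 := (Complex.re_le_norm _).trans (hle.trans h3)
  rw [Complex.sub_re] at h4
  linarith

/-- Growth of the integral means of `‖k‖ ^ p`, which is the square of the modulus of `k ^ (p / 2)`. -/
lemma exists_integral_norm_rpow_le {k : ℂ → ℂ} {μ p a : ℝ} (hp : 0 < p)
    (hk : DifferentiableOn ℂ k disk) (h0 : ∀ z ∈ disk, k z ≠ 0)
    (hb : ∀ z ∈ disk, (1 - ‖z‖ ^ 2) * ‖deriv k z / k z‖ ≤ μ) (ha : 0 ≤ a)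
    (hpa : (p * μ / 2) ^ 2 ≤ a * (a + 1)) :
    ∃ C, ∀ x ∈ Ico (-1 : ℝ) 0,
      ∫ θ in (0 : ℝ)..(2 * Real.pi), ‖k (Complex.exp (x + θ * Complex.I))‖ ^ p ≤
        C * (-x) ^ (-a) := by
  obtain ⟨M, hMd, hMp, hM', hkM⟩ := exists_log_comp_exp hk h0 hb
  set Φ : ℂ → ℂ := fun ζ => Complex.exp ((p / 2 : ℝ) * M ζ) with hΦ
  have hΦ' : ∀ ζ ∈ leftHalfPlane, HasDerivAt Φ (Φ ζ * ((p / 2 : ℝ) * deriv M ζ)) ζ := fun ζ hζ =>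
    ((hMd.differentiableAt (isOpen_leftHalfPlane.mem_nhds hζ)).hasDerivAt.const_mul _).cexp
  obtain ⟨C, hC⟩ := exists_integral_norm_sq_le (Φ := Φ) (κ := p * μ / 2)
    (fun ζ hζ => (hΦ' ζ hζ).differentiableAt.differentiableWithinAt)
    (fun ζ => by simp only [hΦ, hMp])
    (fun ζ hζ => by
      rw [(hΦ' ζ hζ).deriv, norm_mul, norm_mul, Complex.norm_real,
        Real.norm_of_nonneg (by positivity), mul_comm]
      refine mul_le_mul_of_nonneg_right ?_ (norm_nonneg _)
      calc p / 2 * ‖deriv M ζ‖ ≤ p / 2 * (μ / (-2 * ζ.re)) := by gcongr; exact hM' ζ hζ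
        _ = _ := by ring) ha hpa
  refine ⟨‖k 0‖ ^ p * C, fun x hx => ?_⟩
  have e : ∀ θ : ℝ, ‖k (Complex.exp (x + θ * Complex.I))‖ ^ p =
      ‖k 0‖ ^ p * ‖Φ (x + θ * Complex.I)‖ ^ 2 := fun θ => by
    rw [hkM _ (line_mem_leftHalfPlane hx.2 θ), norm_mul,
      Real.mul_rpow (norm_nonneg _) (norm_nonneg _), Complex.norm_exp, Complex.norm_exp,
      ← Real.exp_mul, ← Real.exp_nat_mul, Complex.re_ofReal_mul]
    congr 2
    push_cast
    ring
  simp only [e]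
  rw [intervalIntegral.integral_const_mul, mul_assoc]
  exact mul_le_mul_of_nonneg_left (hC x hx) (by positivity)

/-! ### Boundedness of the integral means of a harmonic mapping -/

lemma summable_half_pow_rpow {c : ℝ} (hc : 0 < c) :
    Summable fun k : ℕ => (((1 : ℝ) / 2) ^ k) ^ c := by
  have : (fun k : ℕ => (((1 : ℝ) / 2) ^ k) ^ c) = fun k : ℕ => (((1 : ℝ) / 2) ^ c) ^ k := by
    funext k
    rw [← Real.rpow_natCast, ← Real.rpow_natCast, ← Real.rpow_mul (by norm_num),
      ← Real.rpow_mul (by norm_num), mul_comm]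
  rw [this]
  exact summable_geometric_of_lt_one (by positivity)
    (Real.rpow_lt_one (by norm_num) (by norm_num) hc)

/-- A weighted sum is controlled by an `ℓ^p` norm with a slightly larger weight. Bounding each term
by the whole `ℓ^p` norm treats all `p > 0` at once. -/
lemma sum_half_pow_mul_le {X : ℕ → ℝ} (hX : ∀ k, 0 ≤ X k) {p b : ℝ} (hp : 0 < p) (hb : b < 1)
    (n : ℕ) :
    ∑ k ∈ Finset.range n, ((1 : ℝ) / 2) ^ k * X k ≤
      (∑' k : ℕ, (((1 : ℝ) / 2) ^ k) ^ (1 - b)) *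
        (∑ k ∈ Finset.range n, (((1 : ℝ) / 2) ^ k) ^ (b * p) * X k ^ p) ^ (1 / p) := by
  set S := ∑ k ∈ Finset.range n, (((1 : ℝ) / 2) ^ k) ^ (b * p) * X k ^ p with hS
  have hnn : ∀ k, 0 ≤ (((1 : ℝ) / 2) ^ k) ^ (b * p) * X k ^ p := fun k =>
    mul_nonneg (by positivity) (Real.rpow_nonneg (hX k) _)
  have hS0 : 0 ≤ S := Finset.sum_nonneg fun k _ => hnn k
  have hterm : ∀ k ∈ Finset.range n, ((1 : ℝ) / 2) ^ k * X k ≤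
      (((1 : ℝ) / 2) ^ k) ^ (1 - b) * S ^ (1 / p) := by
    intro k hk
    have ht : 0 < ((1 : ℝ) / 2) ^ k := by positivity
    have h1 : (((1 : ℝ) / 2) ^ k) ^ b * X k ≤ S ^ (1 / p) := by
      rw [one_div p, Real.le_rpow_inv_iff_of_pos (mul_nonneg (by positivity) (hX k)) hS0 hp,
        Real.mul_rpow (by positivity) (hX k), ← Real.rpow_mul ht.le]
      exact Finset.single_le_sum (f := fun k => (((1 : ℝ) / 2) ^ k) ^ (b * p) * X k ^ p)
        (fun k _ => hnn k) hk
    calc ((1 : ℝ) / 2) ^ k * X k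
        = (((1 : ℝ) / 2) ^ k) ^ (1 - b) * ((((1 : ℝ) / 2) ^ k) ^ b * X k) := by
          rw [← mul_assoc, ← Real.rpow_add ht, sub_add_cancel, Real.rpow_one]
      _ ≤ _ := by gcongr
  calc _ ≤ ∑ k ∈ Finset.range n, (((1 : ℝ) / 2) ^ k) ^ (1 - b) * S ^ (1 / p) :=
        Finset.sum_le_sum hterm
    _ = (∑ k ∈ Finset.range n, (((1 : ℝ) / 2) ^ k) ^ (1 - b)) * S ^ (1 / p) := by
        rw [Finset.sum_mul]
    _ ≤ _ := by
        gcongr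
        exact (summable_half_pow_rpow (by linarith)).sum_le_tsum _ fun _ _ => by positivity

lemma add_rpow_le_two_rpow_mul {x y p : ℝ} (hx : 0 ≤ x) (hy : 0 ≤ y) (hp : 0 < p) :
    (x + y) ^ p ≤ 2 ^ p * (x ^ p + y ^ p) := by
  have h1 : x + y ≤ 2 * max x y := by linarith [le_max_left x y, le_max_right x y]
  calc (x + y) ^ p ≤ (2 * max x y) ^ p := by gcongr
    _ = 2 ^ p * (max x y) ^ p := Real.mul_rpow (by norm_num) (le_max_of_le_left hx)
    _ ≤ _ := by
      gcongr
      rcases max_cases x y with h | h <;> rw [h.1]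
      · linarith [Real.rpow_nonneg hy p]
      · linarith [Real.rpow_nonneg hx p]

/-- The radial increment of `u`, when `‖u'‖ ≤ ‖k‖` and `-log ‖z‖` is at most halved. -/
lemma norm_comp_exp_sub_le {u k : ℂ → ℂ} {μ : ℝ} (hμ : 0 ≤ μ) (hu : DifferentiableOn ℂ u disk)
    (huk : ∀ z ∈ disk, ‖deriv u z‖ ≤ ‖k z‖) (hk : DifferentiableOn ℂ k disk)
    (h0 : ∀ z ∈ disk, k z ≠ 0) (hb : ∀ z ∈ disk, (1 - ‖z‖ ^ 2) * ‖deriv k z / k z‖ ≤ μ)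
    {s t : ℝ} (hs : 0 < s) (hst : s ≤ t) (hts : t ≤ 2 * s) (θ : ℝ) :
    ‖u (Complex.exp (((-s : ℝ) : ℂ) + θ * Complex.I)) -
        u (Complex.exp (((-t : ℝ) : ℂ) + θ * Complex.I))‖ ≤
      Real.exp (μ / 2) * ‖k (Complex.exp (((-t : ℝ) : ℂ) + θ * Complex.I))‖ * (t - s) := by
  have hd : ∀ y ∈ Icc (-t) (-s), HasDerivWithinAt
      (fun y : ℝ => u (Complex.exp (y + θ * Complex.I)))
      (deriv u (Complex.exp (y + θ * Complex.I)) * Complex.exp (y + θ * Complex.I))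
      (Icc (-t) (-s)) y := fun y hy => by
    have h1 := ((hu.differentiableAt (isOpen_ball.mem_nhds (exp_mem_disk
      (line_mem_leftHalfPlane (by linarith [hy.2] : y < 0) θ)))).hasDerivAt).comp _
      (Complex.hasDerivAt_exp (y + θ * Complex.I))
    exact (HasDerivAt.comp_add_const (y : ℂ) (θ * Complex.I) h1).comp_ofReal.hasDerivWithinAt
  have hle := (convex_Icc (-t) (-s)).norm_image_sub_le_of_norm_hasDerivWithin_le
    (C := Real.exp (μ / 2) * ‖k (Complex.exp (((-t : ℝ) : ℂ) + θ * Complex.I))‖) hd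
    (fun y hy => by
      have hmem := exp_mem_disk (line_mem_leftHalfPlane (by linarith [hy.2] : y < 0) θ)
      have h1 := norm_comp_exp_le hμ hk h0 hb (s := -y) (t := t) (by linarith [hy.2])
        (by linarith [hy.1]) (by linarith [hy.2]) θ
      rw [neg_neg] at h1
      rw [norm_mul]
      calc _ ≤ ‖k (Complex.exp (y + θ * Complex.I))‖ * 1 :=
            mul_le_mul (huk _ hmem) (mem_ball_zero_iff.mp hmem).le (norm_nonneg _) (norm_nonneg _)
        _ ≤ _ := by rwa [mul_one])
    (left_mem_Icc.mpr (by linarith)) (right_mem_Icc.mpr (by linarith))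
  rwa [Real.norm_of_nonneg (by linarith : 0 ≤ -s - -t), sub_neg_eq_add, neg_add_eq_sub] at hle

/-- A harmonic mapping `h + conj g` with `‖g'‖ ≤ ‖h'‖`, whose analytic part has pre-Schwarzian norm
at most `μ`, lies in `h^p` when `p (μ² - 4) < 4`. The means of `‖h'‖ ^ p` grow at most like
`(1 - r) ^ (-a)` with `4 a (a + 1) = p² μ²`, and the condition on `p` says that `a < p`. -/
theorem hardyNorm_lt_top {f h g : ℂ → ℂ} (hc : IsCanonicalRep f h g) {μ p : ℝ} (hμ : 0 ≤ μ)
    (hp : 0 < p) (h0 : ∀ z ∈ disk, deriv h z ≠ 0)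
    (hgh : ∀ z ∈ disk, ‖deriv g z‖ ≤ ‖deriv h z‖)
    (hb : ∀ z ∈ disk, (1 - ‖z‖ ^ 2) * ‖deriv (deriv h) z / deriv h z‖ ≤ μ)
    (hpμ : p * μ ^ 2 < 4 * (p + 1)) : hardyNorm p f < ∞ := by
  have hk : DifferentiableOn ℂ (deriv h) disk := hc.analytic_h.deriv isOpen_ball
  have hfc : ContinuousOn f disk :=
    (hc.analytic_h.continuousOn.add
      (Complex.continuous_conj.comp_continuousOn hc.analytic_g.continuousOn)).congr hc.eq_add
  -- `a` is the positive root of `4 a (a + 1) = p² μ²`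
  obtain ⟨a, ha, hap, hpa⟩ : ∃ a : ℝ, 0 ≤ a ∧ a < p ∧ (p * μ / 2) ^ 2 ≤ a * (a + 1) := by
    set q := √(1 + (p * μ) ^ 2) with hq
    have hq2 : q ^ 2 = 1 + (p * μ) ^ 2 := Real.sq_sqrt (by positivity)
    have hq1 : 1 ≤ q := Real.one_le_sqrt.mpr (by nlinarith [sq_nonneg (p * μ)])
    refine ⟨(q - 1) / 2, by linarith, ?_, by nlinarith⟩
    have : q < 2 * p + 1 := by
      refine lt_of_pow_lt_pow_left₀ 2 (by linarith) ?_
      rw [hq2]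
      nlinarith [mul_lt_mul_of_pos_left hpμ hp]
    linarith
  -- `b` is the midpoint of `a / p` and `1`
  set b := (a + p) / (2 * p) with hbdef
  have hbp : b * p = (a + p) / 2 := by rw [hbdef]; field_simp
  have hb1 : b < 1 := by rw [hbdef, div_lt_one (by linarith)]; linarith
  obtain ⟨C, hC⟩ := exists_integral_norm_rpow_le hp hk h0 hb ha hpa
  have hsub : closedBall (0 : ℂ) (Real.exp (-1)) ⊆ disk :=
    closedBall_subset_ball (Real.exp_lt_one_iff.mpr (by norm_num))
  obtain ⟨M₀, hM₀⟩ := (isCompact_closedBall (0 : ℂ) (Real.exp (-1))).exists_bound_of_continuousOn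
    (hfc.mono hsub)
  have hM₀0 : 0 ≤ M₀ := (norm_nonneg _).trans (hM₀ 0 (by simp [Real.exp_nonneg]))
  have hinner : ∀ s θ : ℝ, 1 ≤ s → ‖f (Complex.exp (((-s : ℝ) : ℂ) + θ * Complex.I))‖ ≤ M₀ := by
    intro s θ hs
    refine hM₀ _ ?_
    rw [mem_closedBall_zero_iff, Complex.norm_exp]
    simpa using hs
  set t : ℕ → ℝ := fun k => (1 / 2) ^ k with ht
  have ht0 : ∀ k, 0 < t k := fun k => by positivity
  have htS : ∀ k, t (k + 1) = t k / 2 := fun k => by simp only [ht, pow_succ]; ring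
  have ht1 : ∀ k, t k ≤ 1 := fun k => pow_le_one₀ (by norm_num) (by norm_num)
  set X : ℕ → ℝ → ℝ := fun k θ =>
    ‖deriv h (Complex.exp (((-t k : ℝ) : ℂ) + θ * Complex.I))‖ with hX
  set E := Real.exp (μ / 2) with hE
  -- the increments of `f` on one dyadic radial step
  have hstep : ∀ (n : ℕ) (s θ : ℝ), t (n + 1) ≤ s → s ≤ t n →
      ‖f (Complex.exp (((-s : ℝ) : ℂ) + θ * Complex.I))‖ ≤
        ‖f (Complex.exp (((-t n : ℝ) : ℂ) + θ * Complex.I))‖ + E * (t n * X n θ) := by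
    intro n s θ h1 h2
    have hs : 0 < s := (ht0 _).trans_le h1
    have hts : t n ≤ 2 * s := by linarith [htS n]
    have m1 := exp_mem_disk (line_mem_leftHalfPlane (by linarith : -s < 0) θ)
    have m2 := exp_mem_disk (line_mem_leftHalfPlane (by linarith [ht0 n] : -t n < 0) θ)
    have i1 := norm_comp_exp_sub_le hμ hc.analytic_h (fun _ _ => le_rfl) hk h0 hb hs h2 hts θ
    have i2 := norm_comp_exp_sub_le hμ hc.analytic_g hgh hk h0 hb hs h2 hts θ
    rw [hc.eq_add _ m1, hc.eq_add _ m2]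
    set z := Complex.exp (((-s : ℝ) : ℂ) + θ * Complex.I)
    set w := Complex.exp (((-t n : ℝ) : ℂ) + θ * Complex.I)
    have e : h z + conj (g z) = (h w + conj (g w)) + ((h z - h w) + conj (g z - g w)) := by
      rw [map_sub]; ring
    rw [e]
    have hEX : 0 ≤ E * X n θ := by positivity
    have i3 : E * X n θ * (t n - s) ≤ E * X n θ * (t n / 2) := by
      gcongr
      linarith [htS n]
    calc _ ≤ ‖h w + conj (g w)‖ + (‖h z - h w‖ + ‖conj (g z - g w)‖) :=
          (norm_add_le _ _).trans (by gcongr; exact norm_add_le _ _)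
      _ ≤ ‖h w + conj (g w)‖ + (E * X n θ * (t n / 2) + E * X n θ * (t n / 2)) := by
          rw [Complex.norm_conj]
          gcongr
          · exact i1.trans i3
          · exact i2.trans i3
      _ = _ := by ring
  have hgrid : ∀ (n : ℕ) (θ : ℝ), ‖f (Complex.exp (((-t n : ℝ) : ℂ) + θ * Complex.I))‖ ≤
      M₀ + E * ∑ k ∈ Finset.range n, t k * X k θ := by
    intro n θ
    induction n with
    | zero => simpa using hinner (t 0) θ (by simp [ht])
    | succ n ih =>
      refine (hstep n (t (n + 1)) θ le_rfl (by linarith [htS n, ht0 n])).trans ?_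
      rw [Finset.sum_range_succ]
      linarith
  set T := ∑' k : ℕ, (((1 : ℝ) / 2) ^ k) ^ (1 - b) with hT
  have hT0 : 0 ≤ T := tsum_nonneg fun _ => by positivity
  set S : ℕ → ℝ → ℝ := fun n θ => ∑ k ∈ Finset.range n, t k ^ (b * p) * X k θ ^ p with hS
  have hS0 : ∀ n θ, 0 ≤ S n θ := fun n θ => Finset.sum_nonneg fun k _ => by positivity
  have hpt : ∀ s : ℝ, 0 < s → ∃ n, ∀ θ : ℝ,
      ‖f (Complex.exp (((-s : ℝ) : ℂ) + θ * Complex.I))‖ ^ p ≤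
        2 ^ p * (M₀ ^ p + (E * T) ^ p * S n θ) := by
    intro s hs
    obtain ⟨n, hn⟩ : ∃ n, ∀ θ : ℝ, ‖f (Complex.exp (((-s : ℝ) : ℂ) + θ * Complex.I))‖ ≤
        M₀ + E * ∑ k ∈ Finset.range n, t k * X k θ := by
      rcases le_total 1 s with h1 | h1
      · exact ⟨0, fun θ => by simpa using hinner s θ h1⟩
      · obtain ⟨n, hn1, hn2⟩ := exists_nat_pow_near_of_lt_one hs h1
          (by norm_num : (0 : ℝ) < 1 / 2) (by norm_num)
        refine ⟨n + 1, fun θ => (hstep n s θ hn1.le hn2).trans ?_⟩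
        rw [Finset.sum_range_succ]
        linarith [hgrid n θ]
    refine ⟨n, fun θ => ?_⟩
    have h1 := sum_half_pow_mul_le (X := fun k => X k θ) (fun k => norm_nonneg _) hp hb1 n
    have h2 : ‖f (Complex.exp (((-s : ℝ) : ℂ) + θ * Complex.I))‖ ≤
        M₀ + E * T * S n θ ^ (1 / p) := by
      refine (hn θ).trans ?_
      rw [mul_assoc]
      gcongr
    calc _ ≤ (M₀ + E * T * S n θ ^ (1 / p)) ^ p := by gcongr
      _ ≤ 2 ^ p * (M₀ ^ p + (E * T * S n θ ^ (1 / p)) ^ p) :=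
          add_rpow_le_two_rpow_mul hM₀0 (by have := hS0 n θ; positivity) hp
      _ = _ := by
          rw [Real.mul_rpow (by positivity) (Real.rpow_nonneg (hS0 n θ) _),
            ← Real.rpow_mul (hS0 n θ), one_div_mul_cancel hp.ne', Real.rpow_one]
  -- integration over the circle
  have hXc : ∀ k, Continuous fun θ => t k ^ (b * p) * X k θ ^ p := fun k => by
    have h1 : Continuous fun θ : ℝ =>
        deriv h (Complex.exp (((-t k : ℝ) : ℂ) + θ * Complex.I)) :=
      continuousOn_univ.mp <| hk.continuousOn.comp (by fun_prop) fun θ _ =>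
        exp_mem_disk (line_mem_leftHalfPlane (by linarith [ht0 k] : -t k < 0) θ)
    exact continuous_const.mul (h1.norm.rpow_const fun _ => Or.inr hp.le)
  have hC0 : 0 ≤ C := by
    have h1 := hC (-1) ⟨le_rfl, by norm_num⟩
    rw [neg_neg, Real.one_rpow, mul_one] at h1
    exact (intervalIntegral.integral_nonneg (by positivity) fun _ _ => by positivity).trans h1
  set T' := ∑' k : ℕ, (((1 : ℝ) / 2) ^ k) ^ (b * p - a) with hT'
  have hSint : ∀ n, ∫ θ in (0 : ℝ)..(2 * Real.pi), S n θ ≤ C * T' := by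
    intro n
    simp only [hS]
    rw [intervalIntegral.integral_finsetSum fun k _ => (hXc k).intervalIntegrable _ _]
    calc _ ≤ ∑ k ∈ Finset.range n, C * t k ^ (b * p - a) := by
          refine Finset.sum_le_sum fun k _ => ?_
          rw [intervalIntegral.integral_const_mul]
          have h1 := hC (-t k) ⟨by linarith [ht1 k], by linarith [ht0 k]⟩
          rw [neg_neg] at h1
          calc _ ≤ t k ^ (b * p) * (C * t k ^ (-a)) := by gcongr
            _ = _ := by
              rw [mul_left_comm, ← Real.rpow_add (ht0 k), ← sub_eq_add_neg]
      _ = C * ∑ k ∈ Finset.range n, t k ^ (b * p - a) := by rw [Finset.mul_sum]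
      _ ≤ C * T' := by
          gcongr
          exact (summable_half_pow_rpow (by linarith)).sum_le_tsum _ fun _ _ => by positivity
  set B := (2 * Real.pi)⁻¹ * (2 ^ p * (2 * Real.pi * M₀ ^ p + (E * T) ^ p * (C * T'))) with hB
  have hmean : ∀ r ∈ Ioo (0 : ℝ) 1, integralMean p r f ≤ B := by
    intro r hr
    have hs : 0 < -Real.log r := by linarith [Real.log_neg hr.1 hr.2]
    obtain ⟨n, hn⟩ := hpt _ hs
    have he : ∀ θ : ℝ, circleMap 0 r θ =
        Complex.exp (((-(-Real.log r) : ℝ) : ℂ) + θ * Complex.I) := fun θ => by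
      rw [neg_neg, Complex.exp_add, ← Complex.ofReal_exp, Real.exp_log hr.1]
      simp [circleMap]
    rw [integralMean, hB]
    gcongr
    have hlc : Continuous fun θ : ℝ => ‖f (circleMap 0 r θ)‖ ^ p := by
      have h1 : Continuous fun θ : ℝ => f (circleMap 0 r θ) :=
        continuousOn_univ.mp <| hfc.comp (continuous_circleMap 0 r).continuousOn fun θ _ => by
          simpa [abs_of_pos hr.1] using hr.2
      exact h1.norm.rpow_const fun _ => Or.inr hp.le
    have hSc : Continuous (S n) := continuous_finsetSum _ fun k _ => hXc k
    have hSc' : Continuous fun θ => (E * T) ^ p * S n θ := continuous_const.mul hSc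
    have hrc : Continuous fun θ => 2 ^ p * (M₀ ^ p + (E * T) ^ p * S n θ) :=
      continuous_const.mul (continuous_const.add hSc')
    calc _ ≤ ∫ θ in (0 : ℝ)..(2 * Real.pi), 2 ^ p * (M₀ ^ p + (E * T) ^ p * S n θ) := by
          refine intervalIntegral.integral_mono (by positivity) (hlc.intervalIntegrable _ _)
            (hrc.intervalIntegrable _ _) fun θ => ?_
          simp only [he]
          exact hn θ
      _ = 2 ^ p * (2 * Real.pi * M₀ ^ p +
            (E * T) ^ p * ∫ θ in (0 : ℝ)..(2 * Real.pi), S n θ) := by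
          rw [intervalIntegral.integral_const_mul, intervalIntegral.integral_add
            (continuous_const.intervalIntegrable _ _)
            (hSc'.intervalIntegrable _ _),
            intervalIntegral.integral_const_mul, intervalIntegral.integral_const]
          simp
      _ ≤ _ := by
          gcongr
          exact hSint n
  refine lt_of_le_of_lt (iSup₂_le fun r hr => ?_) (ENNReal.ofReal_lt_top (r := B ^ (1 / p)))
  refine ENNReal.ofReal_le_ofReal (Real.rpow_le_rpow ?_ (hmean r hr) (by positivity))
  exact mul_nonneg (by positivity)
    (intervalIntegral.integral_nonneg (by positivity) fun _ _ => by positivity)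

/-! ### Harmonic mappings close to the exponential function -/

/-- If `k' / k` is `1` at `0` and bounded by `2` on a large disk, then it is close to `1` on a fixed
disk by the Schwarz lemma, so `k` is close to a multiple of the exponential function there. -/
lemma norm_div_exp_sub_one_le {k : ℂ → ℂ} {R : ℝ} (hR : 192 ≤ R)
    (hk : DifferentiableOn ℂ k (ball 0 R)) (h0 : ∀ z ∈ ball (0 : ℂ) R, k z ≠ 0)
    (h1 : deriv k 0 = k 0) (h2 : ∀ z ∈ ball (0 : ℂ) R, ‖deriv k z‖ ≤ 2 * ‖k z‖) {z : ℂ}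
    (hz : ‖z‖ < 8) : ‖k z / (k 0 * Complex.exp z) - 1‖ ≤ 384 / R := by
  have hR0 : 0 < R := by linarith
  have m0 : (0 : ℂ) ∈ ball (0 : ℂ) R := mem_ball_self hR0
  have hsub : ball (0 : ℂ) 8 ⊆ ball 0 R := ball_subset_ball (by linarith)
  have hz' : z ∈ ball (0 : ℂ) 8 := by simpa using hz
  obtain ⟨L, hL0, hL, hkL⟩ := exists_exp_eq_of_ne_zero hR0 hk h0
  set q : ℂ → ℂ := fun z => deriv k z / k z with hq
  have hqd : DifferentiableOn ℂ q (ball 0 R) := (hk.deriv isOpen_ball).div hk h0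
  have hq0 : q 0 = 1 := by simp only [hq]; rw [h1, div_self (h0 0 m0)]
  have hqb : ∀ w ∈ ball (0 : ℂ) 8, ‖q w - 1‖ ≤ 24 / R := by
    intro w hw
    have := Complex.dist_le_div_mul_dist_of_mapsTo_ball (R₂ := 3) hqd (fun y hy => by
      rw [mem_closedBall, hq0, dist_eq_norm]
      have h3 : ‖q y‖ ≤ 2 := by
        simp only [hq]
        rw [norm_div, div_le_iff₀ (norm_pos_iff.mpr (h0 y hy))]
        exact h2 y hy
      calc ‖q y - 1‖ ≤ ‖q y‖ + ‖(1 : ℂ)‖ := norm_sub_le _ _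
        _ ≤ 3 := by rw [norm_one]; linarith) (hsub hw)
    rw [hq0, dist_eq_norm, dist_zero_right] at this
    refine this.trans ?_
    rw [div_mul_eq_mul_div]
    have := mem_ball_zero_iff.mp hw
    gcongr
    linarith
  have hD := (convex_ball (0 : ℂ) 8).norm_image_sub_le_of_norm_hasDerivWithin_le
    (f := fun w => L w - w) (C := 24 / R)
    (fun w hw => ((hL w (hsub hw)).sub (hasDerivAt_id w)).hasDerivWithinAt) hqb
    (mem_ball_self (by norm_num)) hz'
  simp only [hL0, sub_zero] at hD
  have hD' : ‖L z - z‖ ≤ 192 / R := by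
    refine hD.trans ?_
    rw [div_mul_eq_mul_div]
    gcongr
    linarith
  have e : k z / (k 0 * Complex.exp z) = Complex.exp (L z - z) := by
    rw [hkL z (hsub hz'), Complex.exp_sub, mul_div_mul_left _ _ (h0 0 m0)]
  rw [e]
  refine (Complex.norm_exp_sub_one_le (hD'.trans ?_)).trans ?_
  · rw [div_le_one hR0]; exact hR
  · calc 2 * ‖L z - z‖ ≤ 2 * (192 / R) := by gcongr
      _ = 384 / R := by ring

/-- The Schwarz–Pick lemma on a large disk: a holomorphic map into the unit disk is nearly constant
on a fixed disk, relative to the distance of its central value from the unit circle. -/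
lemma norm_sub_le_of_large_radius {w : ℂ → ℂ} {R : ℝ} (hR : 16 ≤ R)
    (hd : DifferentiableOn ℂ w (ball 0 R)) (hm : ∀ y ∈ ball (0 : ℂ) R, ‖w y‖ < 1) {z : ℂ}
    (hz : ‖z‖ < 8) : ‖w z - w 0‖ ≤ 16 / R * (1 - ‖w 0‖ ^ 2) := by
  have hR0 : 0 < R := by linarith
  have hw0 := hm 0 (mem_ball_self hR0)
  have h1 := norm_sub_le_mul_norm_one_sub_conj_mul hd hm
    (z := z) (mem_ball_zero_iff.mpr (by linarith))
  rw [sub_zero] at h1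
  have hpos : 0 < 1 - ‖w 0‖ ^ 2 := by nlinarith [norm_nonneg (w 0)]
  have h2 : ‖1 - conj (w 0) * w z‖ ≤ (1 - ‖w 0‖ ^ 2) + ‖w z - w 0‖ := by
    have e : 1 - conj (w 0) * w z =
        ((1 - ‖w 0‖ ^ 2 : ℝ) : ℂ) - conj (w 0) * (w z - w 0) := by
      have := Complex.mul_conj (w 0)
      rw [Complex.normSq_eq_norm_sq] at this
      push_cast at this ⊢
      rw [← this]
      ring
    rw [e]
    refine (norm_sub_le _ _).trans ?_
    rw [Complex.norm_real, Real.norm_of_nonneg hpos.le, norm_mul, Complex.norm_conj]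
    gcongr
    exact mul_le_of_le_one_left (norm_nonneg _) hw0.le
  have ht : ‖z‖ / R ≤ 8 / R := by gcongr
  have ht2 : 8 / R ≤ 1 / 2 := by rw [div_le_div_iff₀ hR0 two_pos]; linarith
  have h3 : ‖w z - w 0‖ ≤ 8 / R * ((1 - ‖w 0‖ ^ 2) + ‖w z - w 0‖) :=
    h1.trans (mul_le_mul ht h2 (norm_nonneg _) (by positivity))
  have h4 : 8 / R * ‖w z - w 0‖ ≤ 1 / 2 * ‖w z - w 0‖ := by gcongr
  calc ‖w z - w 0‖ ≤ 2 * (8 / R * (1 - ‖w 0‖ ^ 2)) := by linarith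
    _ = _ := by ring

/-- A mapping whose difference from the exponential function has a small Lipschitz constant takes
some value both near `0` and at `2πi`. -/
lemma exists_eq_of_norm_sub_exp_le {F : ℂ → ℂ}
    (hF : ∀ x ∈ ball (0 : ℂ) 8, ∀ y ∈ ball (0 : ℂ) 8,
      ‖(F x - Complex.exp x) - (F y - Complex.exp y)‖ ≤ 1 / 500 * ‖x - y‖) :
    ∃ x ∈ closedBall (0 : ℂ) (1 / 4), F x = F (2 * Real.pi * Complex.I) := by
  have hexp : ∀ x ∈ closedBall (0 : ℂ) (1 / 4), ∀ y ∈ closedBall (0 : ℂ) (1 / 4),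
      ‖(Complex.exp x - x) - (Complex.exp y - y)‖ ≤ 1 / 2 * ‖x - y‖ := fun x hx y hy =>
    (convex_closedBall (0 : ℂ) (1 / 4)).norm_image_sub_le_of_norm_hasDerivWithin_le
      (f := fun w => Complex.exp w - w) (C := 1 / 2)
      (fun w _ => ((Complex.hasDerivAt_exp w).sub (hasDerivAt_id w)).hasDerivWithinAt)
      (fun w hw => by
        have hw' := mem_closedBall_zero_iff.mp hw
        have := Complex.norm_exp_sub_one_le (x := w) (by linarith)
        linarith) hy hx
  have hsub : closedBall (0 : ℂ) (1 / 4) ⊆ ball 0 8 := closedBall_subset_ball (by norm_num)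
  have happ : ApproximatesLinearOn F
      ((ContinuousLinearEquiv.refl ℂ ℂ : ℂ ≃L[ℂ] ℂ) : ℂ →L[ℂ] ℂ) (closedBall 0 (1 / 4))
      (3 / 4 : NNReal) := by
    intro x hx y hy
    have e : F x - F y - ((ContinuousLinearEquiv.refl ℂ ℂ : ℂ ≃L[ℂ] ℂ) : ℂ →L[ℂ] ℂ) (x - y) =
        ((F x - Complex.exp x) - (F y - Complex.exp y)) +
          ((Complex.exp x - x) - (Complex.exp y - y)) := by
      simp
      ring
    rw [e]
    have h1 := hF x (hsub hx) y (hsub hy)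
    have h2 := hexp x hx y hy
    have h3 : ((3 / 4 : NNReal) : ℝ) = 3 / 4 := by norm_num
    rw [h3]
    linarith [norm_add_le ((F x - Complex.exp x) - (F y - Complex.exp y))
      ((Complex.exp x - x) - (Complex.exp y - y)), norm_nonneg (x - y)]
  have hsurj := happ.surjOn_closedBall_of_nonlinearRightInverse
    (ContinuousLinearEquiv.refl ℂ ℂ : ℂ ≃L[ℂ] ℂ).toNonlinearRightInverse
    (b := 0) (ε := 1 / 4) (by norm_num) Subset.rfl
  have hn2 : ‖(2 * Real.pi * Complex.I : ℂ)‖ = 2 * Real.pi := by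
    simp [abs_of_pos Real.pi_pos]
  have hmem : F (2 * Real.pi * Complex.I) ∈ closedBall (F 0) (1 / 16) := by
    rw [mem_closedBall, dist_eq_norm]
    have h1 := hF (2 * Real.pi * Complex.I)
      (by rw [mem_ball_zero_iff, hn2]; linarith [Real.pi_lt_d2]) 0 (by simp)
    rw [Complex.exp_two_pi_mul_I, Complex.exp_zero, sub_sub_sub_cancel_right, sub_zero, hn2] at h1
    linarith [Real.pi_lt_d2]
  obtain ⟨x, hx, hxe⟩ := hsurj (show F (2 * Real.pi * Complex.I) ∈ _ by
    refine closedBall_subset_closedBall ?_ hmem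
    have : ((ContinuousLinearEquiv.refl ℂ ℂ : ℂ ≃L[ℂ] ℂ).toNonlinearRightInverse.nnnorm : ℝ) =
        1 := by
      change ‖(((ContinuousLinearEquiv.refl ℂ ℂ : ℂ ≃L[ℂ] ℂ).symm : ℂ ≃L[ℂ] ℂ) : ℂ →L[ℂ] ℂ)‖ = 1
      exact ContinuousLinearMap.norm_id
    rw [this]
    norm_num)
  exact ⟨x, hx, hxe⟩

lemma eq_of_sub_mul_conj_eq {c u v : ℂ} (hc : ‖c‖ < 1)
    (h : u - conj c * conj u = v - conj c * conj v) : u = v := by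
  have h1 : u - v = conj c * conj (u - v) := by rw [map_sub]; linear_combination h
  have h2 := congrArg norm h1
  rw [norm_mul, Complex.norm_conj, Complex.norm_conj] at h2
  by_contra hne
  have : 0 < ‖u - v‖ := norm_pos_iff.mpr (sub_ne_zero.mpr hne)
  nlinarith

/-- A sense-preserving harmonic mapping of a very large disk whose analytic part satisfies
`h'' / h' = 1` at the center and `|h'' / h'| ≤ 2` is not univalent: up to a real-linear change of
coordinates in the image, it is close to the exponential function. -/
lemma not_injOn_of_large_radius {f h g : ℂ → ℂ} {R : ℝ} (hR : 10 ^ 10 ≤ R)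
    (hh : DifferentiableOn ℂ h (ball 0 R)) (hg : DifferentiableOn ℂ g (ball 0 R))
    (hf : ∀ z ∈ ball (0 : ℂ) R, f z = h z + conj (g z))
    (hgh : ∀ z ∈ ball (0 : ℂ) R, ‖deriv g z‖ < ‖deriv h z‖)
    (h1 : deriv (deriv h) 0 = deriv h 0)
    (h2 : ∀ z ∈ ball (0 : ℂ) R, ‖deriv (deriv h) z‖ ≤ 2 * ‖deriv h z‖) :
    ¬ InjOn f (ball 0 R) := by
  have hR0 : 0 < R := by linarith
  have hsub : ball (0 : ℂ) 8 ⊆ ball 0 R := ball_subset_ball (by linarith)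
  have hne : ∀ z ∈ ball (0 : ℂ) R, deriv h z ≠ 0 := fun z hz =>
    norm_pos_iff.mp ((norm_nonneg _).trans_lt (hgh z hz))
  have m0 : (0 : ℂ) ∈ ball (0 : ℂ) R := mem_ball_self hR0
  have hk := hh.deriv isOpen_ball
  set ω : ℂ → ℂ := fun z => deriv g z / deriv h z with hω
  have hωd : DifferentiableOn ℂ ω (ball 0 R) := (hg.deriv isOpen_ball).div hk hne
  have hωm : ∀ z ∈ ball (0 : ℂ) R, ‖ω z‖ < 1 := fun z hz => by
    simp only [hω]
    rw [norm_div, div_lt_one (norm_pos_iff.mpr (hne z hz))]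
    exact hgh z hz
  set c := ω 0 with hcdef
  have hc : ‖c‖ < 1 := hωm 0 m0
  set m := 1 - ‖c‖ ^ 2 with hm
  have hm0 : 0 < m := by nlinarith [norm_nonneg c]
  have hmC : (m : ℂ) ≠ 0 := by exact_mod_cast hm0.ne'
  have hmc : (m : ℂ) = 1 - conj c * c := by
    rw [mul_comm, Complex.mul_conj, Complex.normSq_eq_norm_sq, hm]; push_cast; ring
  set k₀ := deriv h 0 with hk₀
  have hk0 : k₀ ≠ 0 := hne 0 m0
  have hkc : conj k₀ ≠ 0 := (map_ne_zero _).mpr hk0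
  have hexp : ∀ z ∈ ball (0 : ℂ) 8, ‖Complex.exp z‖ ≤ 6561 := fun z hz => by
    rw [Complex.norm_exp]
    have hz8 := (Complex.re_le_norm z).trans (mem_ball_zero_iff.mp hz).le
    calc Real.exp z.re ≤ Real.exp ((8 : ℕ) * 1) := by gcongr; simpa using hz8
      _ = Real.exp 1 ^ 8 := Real.exp_nat_mul 1 8
      _ ≤ 3 ^ 8 := by gcongr; exact Real.exp_one_lt_three.le
      _ = 6561 := by norm_num
  have hα : ∀ z ∈ ball (0 : ℂ) 8, ‖deriv h z / (k₀ * Complex.exp z) - 1‖ ≤ 384 / 10 ^ 10 :=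
    fun z hz => (norm_div_exp_sub_one_le (by linarith) hk hne h1 h2
      (mem_ball_zero_iff.mp hz)).trans (by gcongr)
  have hβ : ∀ z ∈ ball (0 : ℂ) 8, ‖(ω z - c) / m‖ ≤ 16 / 10 ^ 10 := fun z hz => by
    rw [norm_div, Complex.norm_real, Real.norm_of_nonneg hm0.le, div_le_iff₀ hm0]
    refine (norm_sub_le_of_large_radius (by linarith) hωd hωm (mem_ball_zero_iff.mp hz)).trans ?_
    gcongr
  -- `(f - conj c * conj f) / (k₀ * m) - exp = U + conj V`, and the radius `10 ^ 10` is large enough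
  -- for `U'` and `V'` to be small against the factor `exp`, which is at most `3 ^ 8 = 6561`
  set U : ℂ → ℂ := fun z => (h z - conj c * g z) / (k₀ * m) - Complex.exp z with hU
  set V : ℂ → ℂ := fun z => (g z - c * h z) / (conj k₀ * m) with hV
  have dU : ∀ z ∈ ball (0 : ℂ) 8, HasDerivAt U
      ((deriv h z - conj c * deriv g z) / (k₀ * m) - Complex.exp z) z := fun z hz => by
    have n := isOpen_ball.mem_nhds (hsub hz)
    exact (((hh.differentiableAt n).hasDerivAt.sub
      ((hg.differentiableAt n).hasDerivAt.const_mul _)).div_const _).sub (Complex.hasDerivAt_exp z)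
  have dV : ∀ z ∈ ball (0 : ℂ) 8, HasDerivAt V
      ((deriv g z - c * deriv h z) / (conj k₀ * m)) z := fun z hz => by
    have n := isOpen_ball.mem_nhds (hsub hz)
    exact (((hg.differentiableAt n).hasDerivAt.sub
      ((hh.differentiableAt n).hasDerivAt.const_mul _)).div_const _)
  have bU : ∀ z ∈ ball (0 : ℂ) 8,
      ‖(deriv h z - conj c * deriv g z) / (k₀ * m) - Complex.exp z‖ ≤ 1 / 1000 := fun z hz => by
    have hz0 := hne z (hsub hz)
    set α := deriv h z / (k₀ * Complex.exp z) - 1 with hαd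
    set β := (ω z - c) / m with hβd
    have e : (deriv h z - conj c * deriv g z) / (k₀ * m) - Complex.exp z =
        Complex.exp z * (α - (1 + α) * (conj c * β)) := by
      have eh : deriv h z = k₀ * Complex.exp z * (1 + α) := by
        rw [hαd]; field_simp [Complex.exp_ne_zero z]; ring
      have eg : deriv g z = (c + m * β) * deriv h z := by
        have : c + m * β = ω z := by rw [hβd]; field_simp; ring
        rw [this]; simp only [hω]; field_simp
      have hm1 : conj c * c = 1 - m := by rw [hmc]; ring
      rw [eg, eh]
      field_simp
      linear_combination (-(1 + α)) * hm1
    have a1 := hα z hz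
    have b1 := hβ z hz
    have hcb : ‖conj c * β‖ ≤ 16 / 10 ^ 10 := by
      rw [norm_mul, Complex.norm_conj]
      exact (mul_le_of_le_one_left (norm_nonneg _) hc.le).trans b1
    have h1α : ‖1 + α‖ ≤ 2 := (norm_add_le _ _).trans (by rw [norm_one]; linarith)
    rw [e, norm_mul]
    calc ‖Complex.exp z‖ * ‖α - (1 + α) * (conj c * β)‖
        ≤ (6561 : ℝ) * (384 / 10 ^ 10 + 2 * (16 / 10 ^ 10)) := by
          refine mul_le_mul (hexp z hz) ((norm_sub_le _ _).trans ?_) (norm_nonneg _) (by norm_num)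
          rw [norm_mul]
          gcongr
      _ ≤ 1 / 1000 := by norm_num
  have bV : ∀ z ∈ ball (0 : ℂ) 8,
      ‖(deriv g z - c * deriv h z) / (conj k₀ * m)‖ ≤ 1 / 1000 := fun z hz => by
    have hz0 := hne z (hsub hz)
    set α := deriv h z / (k₀ * Complex.exp z) - 1 with hαd
    set β := (ω z - c) / m with hβd
    have e : (deriv g z - c * deriv h z) / (conj k₀ * m) =
        (k₀ / conj k₀) * (Complex.exp z * ((1 + α) * β)) := by
      have eh : deriv h z = k₀ * Complex.exp z * (1 + α) := by
        rw [hαd]; field_simp [Complex.exp_ne_zero z]; ring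
      have eg : deriv g z = (c + m * β) * deriv h z := by
        have : c + m * β = ω z := by rw [hβd]; field_simp; ring
        rw [this]; simp only [hω]; field_simp
      rw [eg, eh]
      field_simp
      ring
    have a1 := hα z hz
    have h1α : ‖1 + α‖ ≤ 2 := (norm_add_le _ _).trans (by rw [norm_one]; linarith)
    rw [e, norm_mul, norm_div, Complex.norm_conj, div_self (norm_ne_zero_iff.mpr hk0), one_mul,
      norm_mul, norm_mul]
    calc ‖Complex.exp z‖ * (‖1 + α‖ * ‖β‖) ≤ (6561 : ℝ) * (2 * (16 / 10 ^ 10)) := by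
          refine mul_le_mul (hexp z hz) ?_ (by positivity) (by norm_num)
          gcongr
          exact hβ z hz
      _ ≤ 1 / 1000 := by norm_num
  set F : ℂ → ℂ := fun z => (f z - conj c * conj (f z)) / (k₀ * m) with hFdef
  have hFe : ∀ z ∈ ball (0 : ℂ) 8, F z - Complex.exp z = U z + conj (V z) := fun z hz => by
    simp only [hFdef, hU, hV]
    rw [hf z (hsub hz)]
    simp only [map_div₀, map_sub, map_mul, map_add, Complex.conj_conj, Complex.conj_ofReal]
    ring
  obtain ⟨x, hx, hxe⟩ := exists_eq_of_norm_sub_exp_le (F := F) fun x hx y hy => by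
    have lU := (convex_ball (0 : ℂ) 8).norm_image_sub_le_of_norm_hasDerivWithin_le
      (fun w hw => (dU w hw).hasDerivWithinAt) bU hy hx
    have lV := (convex_ball (0 : ℂ) 8).norm_image_sub_le_of_norm_hasDerivWithin_le
      (fun w hw => (dV w hw).hasDerivWithinAt) bV hy hx
    rw [hFe x hx, hFe y hy, add_sub_add_comm, ← map_sub]
    refine (norm_add_le _ _).trans ?_
    rw [Complex.norm_conj]
    linarith
  have hn2 : ‖(2 * Real.pi * Complex.I : ℂ)‖ = 2 * Real.pi := by
    simp [abs_of_pos Real.pi_pos]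
  have hx' := mem_closedBall_zero_iff.mp hx
  intro hinj
  have hfx : f x = f (2 * Real.pi * Complex.I) := by
    refine eq_of_sub_mul_conj_eq hc ?_
    simpa only [hFdef, div_left_inj' (mul_ne_zero hk0 hmC)] using hxe
  have hxx := hinj (mem_ball_zero_iff.mpr (by linarith))
    (mem_ball_zero_iff.mpr (by rw [hn2]; linarith [Real.pi_lt_d2])) hfx
  rw [hxx, hn2] at hx'
  linarith [Real.pi_gt_three]

/-! ### Bounds for the pre-Schwarzian derivative of the analytic part -/

/-- The bound for univalence on Euclidean disks of radius comparable to the distance from the unit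
circle. If it fails, a point where `|h'' / h'|` is almost maximal for its distance from the boundary
of a small disk is blown up, and the rescaled mapping is close to the exponential function. -/
lemma one_sub_sq_mul_norm_le_of_injOn {f h g : ℂ → ℂ} (hf : IsSensePreservingHarmonic f)
    (hc : IsCanonicalRep f h g) {s : ℝ} (hs0 : 0 < s) (hs1 : s < 1)
    (hinj : ∀ z ∈ disk, InjOn f (ball z (s * (1 - ‖z‖)))) {z : ℂ} (hz : z ∈ disk) :
    (1 - ‖z‖ ^ 2) * ‖deriv (deriv h) z / deriv h z‖ ≤ 8 * 10 ^ 10 / s := by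
  by_contra! hlt
  have hgh : ∀ z ∈ disk, ‖deriv g z‖ < ‖deriv h z‖ := fun z hz =>
    norm_deriv_lt_of_isSensePreservingHarmonic hf hc hz
  have hne : ∀ z ∈ disk, deriv h z ≠ 0 := fun z hz =>
    norm_pos_iff.mp ((norm_nonneg _).trans_lt (hgh z hz))
  have hz1 : ‖z‖ < 1 := mem_ball_zero_iff.mp hz
  set φ : ℂ → ℝ := fun y => ‖deriv (deriv h) y / deriv h y‖ with hφ
  have hφc : ContinuousOn φ disk :=
    (((hc.analytic_h.deriv isOpen_ball).deriv isOpen_ball).div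
      (hc.analytic_h.deriv isOpen_ball) hne).continuousOn.norm
  set d := s * (1 - ‖z‖) / 2 with hd
  have hd0 : 0 < d := by
    have : 0 < 1 - ‖z‖ := by linarith
    positivity
  have hdz : d + ‖z‖ < 1 := by rw [hd]; nlinarith
  have hφd : 2 * 10 ^ 10 < φ z * d := by
    rw [div_lt_iff₀ hs0] at hlt
    have h0 : 0 ≤ φ z := norm_nonneg _
    have h1 : (1 - ‖z‖ ^ 2) ≤ 2 * (1 - ‖z‖) := by nlinarith [norm_nonneg z]
    have h2 : (1 - ‖z‖ ^ 2) * φ z * s ≤ 2 * (1 - ‖z‖) * φ z * s := by gcongr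
    have h3 : φ z * d = 2 * (1 - ‖z‖) * φ z * s / 4 := by rw [hd]; ring
    rw [h3]
    linarith
  have hsub : closedBall z d ⊆ disk := fun y hy => by
    rw [mem_closedBall, dist_eq_norm] at hy
    rw [mem_ball_zero_iff]
    linarith [norm_le_norm_add_norm_sub' y z]
  obtain ⟨z₁, hz₁, hmax⟩ := (isCompact_closedBall z d).exists_isMaxOn
    (f := fun y => φ y * (d - ‖y - z‖)) ⟨z, mem_closedBall_self hd0.le⟩
    ((hφc.mono hsub).mul (by fun_prop))
  set A := φ z₁ with hA
  set d₁ := d - ‖z₁ - z‖ with hd₁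
  have hAd : 2 * 10 ^ 10 < A * d₁ := by
    have := isMaxOn_iff.mp hmax z (mem_closedBall_self hd0.le)
    simp only [sub_self, norm_zero, sub_zero] at this
    exact hφd.trans_le this
  have hA0 : 0 ≤ A := norm_nonneg _
  have hd₁0 : 0 < d₁ := by
    by_contra! h
    nlinarith [mul_nonpos_of_nonneg_of_nonpos hA0 h]
  have hApos : 0 < A := by
    rcases hA0.eq_or_lt with h | h
    · rw [← h] at hAd; norm_num at hAd
    · exact h
  -- `φ ≤ 2 A` on the disk of half the distance from the boundary
  have hin : ∀ y ∈ ball z₁ (d₁ / 2), ‖y - z‖ < d - d₁ / 2 := fun y hy => by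
    rw [mem_ball, dist_eq_norm] at hy
    have := norm_sub_le_norm_sub_add_norm_sub y z₁ z
    linarith
  have hin' : ∀ y ∈ ball z₁ (d₁ / 2), y ∈ closedBall z d := fun y hy => by
    rw [mem_closedBall, dist_eq_norm]
    linarith [hin y hy]
  have h2A : ∀ y ∈ ball z₁ (d₁ / 2), φ y ≤ 2 * A := fun y hy => by
    have h1 := isMaxOn_iff.mp hmax y (hin' y hy)
    have h2 := hin y hy
    have h3 : φ y * (d₁ / 2) ≤ φ y * (d - ‖y - z‖) := by
      have : 0 ≤ φ y := norm_nonneg _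
      gcongr
      linarith
    have h4 : φ y * (d₁ / 2) ≤ A * d₁ := h3.trans h1
    nlinarith
  -- the rescaling that normalizes the pre-Schwarzian derivative at `z₁`
  set a := deriv (deriv h) z₁ / deriv h z₁ with ha
  have ha0 : a ≠ 0 := norm_pos_iff.mp hApos
  have hmap : ∀ ζ ∈ ball (0 : ℂ) (A * d₁ / 2), z₁ + a⁻¹ * ζ ∈ ball z₁ (d₁ / 2) := fun ζ hζ => by
    rw [mem_ball_zero_iff] at hζ
    rw [mem_ball, dist_eq_norm, add_sub_cancel_left, norm_mul, norm_inv]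
    change A⁻¹ * ‖ζ‖ < d₁ / 2
    rw [inv_mul_lt_iff₀ hApos]
    linarith
  have hmap' : ∀ ζ ∈ ball (0 : ℂ) (A * d₁ / 2), z₁ + a⁻¹ * ζ ∈ disk := fun ζ hζ =>
    hsub (hin' _ (hmap ζ hζ))
  have hderiv : ∀ u : ℂ → ℂ, deriv (fun ζ => u (z₁ + a⁻¹ * ζ)) =
      fun ζ => a⁻¹ * deriv u (z₁ + a⁻¹ * ζ) := fun u => by
    funext ζ
    rw [deriv_comp_mul_left a⁻¹ (fun y => u (z₁ + y)) ζ, deriv_comp_const_add, smul_eq_mul]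
  have hderiv2 : ∀ ζ, deriv (deriv fun ζ => h (z₁ + a⁻¹ * ζ)) ζ =
      a⁻¹ * (a⁻¹ * deriv (deriv h) (z₁ + a⁻¹ * ζ)) := fun ζ => by
    rw [hderiv h, deriv_const_mul_field, hderiv (deriv h)]
  have haff : DifferentiableOn ℂ (fun ζ => z₁ + a⁻¹ * ζ) (ball 0 (A * d₁ / 2)) := by fun_prop
  refine not_injOn_of_large_radius (R := A * d₁ / 2) (f := fun ζ => f (z₁ + a⁻¹ * ζ))
    (h := fun ζ => h (z₁ + a⁻¹ * ζ)) (g := fun ζ => g (z₁ + a⁻¹ * ζ)) (by linarith)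
    (hc.analytic_h.comp haff hmap') (hc.analytic_g.comp haff hmap')
    (fun ζ hζ => hc.eq_add _ (hmap' ζ hζ)) (fun ζ hζ => ?_) ?_ (fun ζ hζ => ?_) ?_
  · rw [hderiv, hderiv, norm_mul, norm_mul]
    have := hgh _ (hmap' ζ hζ)
    gcongr
    exact norm_pos_iff.mpr (inv_ne_zero ha0)
  · rw [hderiv2, hderiv]
    simp only [mul_zero, add_zero]
    congr 1
    rw [ha, inv_div, div_mul_cancel₀]
    intro h0
    exact ha0 (by rw [ha, h0, zero_div])
  · have h1 := h2A _ (hmap ζ hζ)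
    simp only [hφ] at h1
    rw [norm_div, div_le_iff₀ (norm_pos_iff.mpr (hne _ (hmap' ζ hζ)))] at h1
    rw [hderiv2, hderiv, norm_mul, norm_mul, norm_mul, norm_inv]
    change A⁻¹ * (A⁻¹ * _) ≤ 2 * (A⁻¹ * _)
    rw [mul_left_comm 2]
    refine mul_le_mul_of_nonneg_left ?_ (inv_nonneg.mpr hA0)
    rw [inv_mul_le_iff₀ hApos]
    linarith
  · intro x hx y hy hxy
    have hball : ∀ ζ ∈ ball (0 : ℂ) (A * d₁ / 2),
        z₁ + a⁻¹ * ζ ∈ ball z (s * (1 - ‖z‖)) := fun ζ hζ => by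
      have := hin _ (hmap ζ hζ)
      rw [mem_ball, dist_eq_norm]
      linarith
    have := hinj z hz (hball x hx) (hball y hy) hxy
    exact mul_left_cancel₀ (inv_ne_zero ha0) (add_left_cancel this)

lemma ball_subset_hypDisk {z : ℂ} (hz : z ∈ disk) {ρ : ℝ} {r : ℝ≥0∞}
    (hρr : ENNReal.ofReal ρ < r) : ball z (Real.tanh (ρ / 2) * (1 - ‖z‖)) ⊆ hypDisk z r := by
  intro w hw
  have hz1 : ‖z‖ < 1 := mem_ball_zero_iff.mp hz
  have hs1 := Real.tanh_lt_one (ρ / 2)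
  rw [mem_ball, dist_eq_norm] at hw
  have hw1 : ‖w‖ < 1 := by
    have := norm_le_norm_add_norm_sub' w z
    nlinarith
  refine ⟨mem_ball_zero_iff.mpr hw1, lt_of_le_of_lt (ENNReal.ofReal_le_ofReal ?_) hρr⟩
  have h1 : 1 - ‖z‖ ≤ ‖1 - conj z * w‖ := by
    have h2 := norm_sub_norm_le (1 : ℂ) (conj z * w)
    rw [norm_one, norm_mul, Complex.norm_conj] at h2
    nlinarith [norm_nonneg z]
  have h3 : ‖(w - z) / (1 - conj z * w)‖ ≤ Real.tanh (ρ / 2) := by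
    rw [norm_div, div_le_iff₀ (by linarith)]
    have h4 : 0 ≤ Real.tanh (ρ / 2) := by
      by_contra! h
      nlinarith [norm_nonneg (w - z)]
    exact hw.le.trans (by gcongr)
  have h5 := Real.artanh_le_artanh (by linarith [norm_nonneg ((w - z) / (1 - conj z * w))]) hs1 h3
  rw [Real.artanh_tanh] at h5
  rw [hypDist]
  linarith

lemma IsULUHarmonic.exists_bound {f h g : ℂ → ℂ} (hf : IsULUHarmonic f)
    (hc : IsCanonicalRep f h g) :
    ∃ μ : ℝ, 0 < μ ∧ ∀ z ∈ disk, (1 - ‖z‖ ^ 2) * ‖deriv (deriv h) z / deriv h z‖ ≤ μ := by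
  obtain ⟨ρ, hρ0, hρ⟩ := ENNReal.lt_iff_exists_nnreal_btwn.mp hf.2
  have hρ0' : (0 : ℝ) < ρ := by exact_mod_cast hρ0
  have hs0 : 0 < Real.tanh (ρ / 2) := by
    rw [Real.tanh_eq_sinh_div_cosh]
    exact div_pos (Real.sinh_pos_iff.mpr (by positivity)) (Real.cosh_pos _)
  refine ⟨_, by positivity, fun z hz => one_sub_sq_mul_norm_le_of_injOn hf.1 hc hs0
    (Real.tanh_lt_one _) (fun z hz => ?_) hz⟩
  obtain ⟨r, ⟨-, hr⟩, hρr⟩ := lt_sSup_iff.mp (hρ.trans_le (iInf₂_le z hz))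
  exact hr.mono (ball_subset_hypDisk hz (by rwa [ENNReal.ofReal_coe_nnreal]))

/-- The pre-Schwarzian norm of the analytic part exceeds that of `f` by at most `1`: with
`ω = g' / h'`, one has `P_h = P_f + ω' conj ω / (1 - |ω|²)`, and the Schwarz–Pick lemma bounds the
second term. -/
lemma one_sub_sq_mul_norm_le_of_preSchwarzianNorm_le {f h g : ℂ → ℂ}
    (hf : IsSensePreservingHarmonic f) (hc : IsCanonicalRep f h g) {lam : ℝ} (hlam : 0 ≤ lam)
    (hP : preSchwarzianNorm h g ≤ ENNReal.ofReal lam) {z : ℂ} (hz : z ∈ disk) :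
    (1 - ‖z‖ ^ 2) * ‖deriv (deriv h) z / deriv h z‖ ≤ lam + 1 := by
  have hgh : ∀ z ∈ disk, ‖deriv g z‖ < ‖deriv h z‖ := fun z hz =>
    norm_deriv_lt_of_isSensePreservingHarmonic hf hc hz
  have hne : ∀ z ∈ disk, deriv h z ≠ 0 := fun z hz =>
    norm_pos_iff.mp ((norm_nonneg _).trans_lt (hgh z hz))
  have hz1 : ‖z‖ < 1 := mem_ball_zero_iff.mp hz
  have hw : 0 ≤ 1 - ‖z‖ ^ 2 := by nlinarith [norm_nonneg z]
  have h1 : (1 - ‖z‖ ^ 2) * ‖preSchwarzian h g z‖ ≤ lam :=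
    (ENNReal.ofReal_le_ofReal_iff hlam).mp
      ((le_iSup₂ (f := fun z (_ : z ∈ disk) =>
        ENNReal.ofReal ((1 - ‖z‖ ^ 2) * ‖preSchwarzian h g z‖)) z hz).trans hP)
  have hk := hc.analytic_h.deriv isOpen_ball
  have hl := hc.analytic_g.deriv isOpen_ball
  set ω : ℂ → ℂ := fun y => deriv g y / deriv h y with hω
  have hωd : DifferentiableOn ℂ ω disk := hl.div hk hne
  have hωm : ∀ y ∈ disk, ‖ω y‖ < 1 := fun y hy => by
    simp only [hω]
    rw [norm_div, div_lt_one (norm_pos_iff.mpr (hne y hy))]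
    exact hgh y hy
  have h2 := one_sub_sq_mul_norm_deriv_le hωd hωm hz
  have n := isOpen_ball.mem_nhds hz
  have hω' : deriv ω z = (deriv (deriv g) z * deriv h z - deriv g z * deriv (deriv h) z) /
      deriv h z ^ 2 :=
    ((hl.differentiableAt n).hasDerivAt.div (hk.differentiableAt n).hasDerivAt (hne z hz)).deriv
  have hm0 : 0 < 1 - ‖ω z‖ ^ 2 := by nlinarith [norm_nonneg (ω z), hωm z hz]
  have hdecomp : deriv (deriv h) z / deriv h z =
      preSchwarzian h g z + deriv ω z * conj (ω z) / ((1 - ‖ω z‖ ^ 2 : ℝ) : ℂ) := by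
    have hh0 := hne z hz
    have hhc : conj (deriv h z) ≠ 0 := (map_ne_zero _).mpr hh0
    have sqn : ∀ x : ℂ, ((‖x‖ : ℝ) : ℂ) ^ 2 = x * conj x := fun x => by
      rw [Complex.mul_conj, Complex.normSq_eq_norm_sq]; push_cast; ring
    have hJ : deriv h z * conj (deriv h z) - deriv g z * conj (deriv g z) ≠ 0 := by
      rw [← sqn, ← sqn]
      have : 0 < ‖deriv h z‖ ^ 2 - ‖deriv g z‖ ^ 2 := by
        have := hgh z hz
        nlinarith [norm_nonneg (deriv g z)]
      exact_mod_cast this.ne'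
    have hmω : ((1 - ‖ω z‖ ^ 2 : ℝ) : ℂ) =
        (deriv h z * conj (deriv h z) - deriv g z * conj (deriv g z)) /
          (deriv h z * conj (deriv h z)) := by
      push_cast
      rw [sqn]
      simp only [hω, map_div₀]
      field_simp
    rw [hmω, hω', preSchwarzian]
    push_cast
    rw [sqn, sqn]
    simp only [hω, map_div₀]
    have hJ' : deriv h z * conj (deriv h z) - conj (deriv g z) * deriv g z ≠ 0 := by
      rwa [mul_comm (conj (deriv g z))]
    field_simp
    ring
  rw [hdecomp]
  have h3 : (1 - ‖z‖ ^ 2) * ‖deriv ω z * conj (ω z) / ((1 - ‖ω z‖ ^ 2 : ℝ) : ℂ)‖ ≤ 1 := by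
    rw [norm_div, norm_mul, Complex.norm_conj, Complex.norm_real, Real.norm_of_nonneg hm0.le,
      ← mul_div_assoc, div_le_one hm0, ← mul_assoc]
    exact (mul_le_of_le_one_right (by positivity) (hωm z hz).le).trans h2
  calc _ ≤ (1 - ‖z‖ ^ 2) * (‖preSchwarzian h g z‖ +
        ‖deriv ω z * conj (ω z) / ((1 - ‖ω z‖ ^ 2 : ℝ) : ℂ)‖) := by
        gcongr; exact norm_add_le _ _
    _ ≤ _ := by linarith

lemma mul_sq_lt_of_lt_criticalExponent {lam p : ℝ} (hlam : 1 ≤ lam)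
    (hp : (p : EReal) < criticalExponent lam) : p * (lam + 1) ^ 2 < 4 * (p + 1) := by
  rcases hlam.eq_or_lt with rfl | h
  · linarith
  · rw [criticalExponent, if_neg h.ne', EReal.coe_lt_coe_iff,
      lt_div_iff₀ (mul_pos (by linarith) (by linarith))] at hp
    linarith

lemma IsSensePreservingHarmonic.mem_harmonicHardy {f h g : ℂ → ℂ}
    (hf : IsSensePreservingHarmonic f) (hc : IsCanonicalRep f h g) {μ p : ℝ} (hμ : 0 ≤ μ)
    (hp : 0 < p) (hb : ∀ z ∈ disk, (1 - ‖z‖ ^ 2) * ‖deriv (deriv h) z / deriv h z‖ ≤ μ)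
    (hpμ : p * μ ^ 2 < 4 * (p + 1)) : f ∈ harmonicHardy p := by
  have hgh : ∀ z ∈ disk, ‖deriv g z‖ < ‖deriv h z‖ := fun z hz =>
    norm_deriv_lt_of_isSensePreservingHarmonic hf hc hz
  exact ⟨hf.1, hardyNorm_lt_top hc hμ hp
    (fun z hz => norm_pos_iff.mp ((norm_nonneg _).trans_lt (hgh z hz)))
    (fun z hz => (hgh z hz).le) hb hpμ⟩

end HarmonicHardy

theorem theorem8p2 :
    (∀ lam : ℝ, 1 ≤ lam → ∀ p : ℝ, 0 < p → (p : EReal) < HarmonicHardy.criticalExponent lam →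
      HarmonicHardy.classBH lam ⊆ HarmonicHardy.harmonicHardy p) ∧
    (∀ f : ℂ → ℂ, HarmonicHardy.IsULUHarmonic f →
      ∃ p : ℝ, 0 < p ∧ f ∈ HarmonicHardy.harmonicHardy p) := by
  refine ⟨?_, ?_⟩
  · rintro lam hlam p hp hpc f ⟨hf, h, g, hc, -, -, hP⟩
    exact hf.mem_harmonicHardy hc (by linarith) hp
      (fun z hz => HarmonicHardy.one_sub_sq_mul_norm_le_of_preSchwarzianNorm_le hf hc
        (by linarith) hP hz)
      (HarmonicHardy.mul_sq_lt_of_lt_criticalExponent hlam hpc)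
  · intro f hf
    obtain ⟨h, g, hc⟩ := HarmonicHardy.exists_isCanonicalRep hf.1.1
    obtain ⟨μ, hμ, hb⟩ := hf.exists_bound hc
    refine ⟨1 / μ ^ 2, by positivity, hf.1.mem_harmonicHardy hc hμ.le (by positivity) hb ?_⟩
    have : 0 < 1 / μ ^ 2 := by positivity
    rw [one_div_mul_cancel (by positivity)]
    linarith
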